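/- **Notation.** $\mathbb N=\{1,2,\dots\}$; $[M]$ is the set of infinite subsets of $M\subset\mathbb N$; $E<F$ means $\max E<\min F$, and $n\le E$ means $n\le\min E$; $\mathbb K$ is $\mathbb R$ or $\mathbb C$; $\omega_1$ is the first uncountable ordinal; for ordinals $\iota\le\xi$, $\xi-\iota$ is the unique ordinal $\varrho$ with $\iota+\varrho=\xi$. **Schreier families.** $\mathcal S_0=\{\varnothing\}\cup\{\{n\}:n\in\mathbb N\}$; $\mathcal S_{\xi+1}=\{\varnothing\}\cup\{\bigcup_{i=1}^kE_i:\ k\le E_1<\dots<E_k,\ \varnothing\ne E_i\in\mathcal S_\xi\}$; for a limit ordinal $\xi<\omega_1$ one fixes a sequence $\xi_n\uparrow\xi$ with $\mathcal S_{\xi_n+1}\subset\mathcal S_{\xi_{n+1}}$ for all $n$, and $\mathcal S_\xi=\{\varnothing\}\cup\{E\ne\varnothing \text{ finite}:\ E\in\mathcal S_{\xi_n+1}\text{ for some } n\le E\}$. The theorem below holds for every such choice of sequences. **Schreier spaces.** $X_\xi$ is the completion of the space $c_{00}$ of finitely supported $\mathbb K$-valued sequences on $\mathbb N$ under $\|x\|_\xi=\sup_{E\in\mathcal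 S_\xi}\sum_{i\in E}|x_i|$; $(e^\xi_j)$ is its canonical basis and $(f^\xi_j)\subset X_\xi^*$ are the coordinate functionals. $|x|$ and $|x^*|$ are the coordinatewise moduli of $x\in X_\xi$ and $x^*\in X_\xi^*$ (so $f_j^\xi(|x|)=|f^\xi_j(x)|$ and $|x^*|(e^\xi_j)=|x^*(e^\xi_j)|$). A block sequence in $X_\xi$ (in $X_\xi^*$) is a sequence of nonzero vectors $x_i\in\mathrm{span}\{e^\xi_j:j\in E_i\}$ (resp. $\mathrm{span}\{f^\xi_j:j\in E_i\}$) with finite sets $E_1<E_2<\cdots$. Two sequences $(x_i),(y_i)$ in normed spaces are equivalent, $(x_i)\approx(y_i)$, if there is $C$ with $\|\sum a_ix_i\|\le C\|\sum a_iy_i\|$ and $\|\sum a_iy_i\|\le C\|\sum a_ix_i\|$ for all $(a_i)\in c_{00}$. **Schreier pairs.** Normalized block sequences $(x_i)\subset X_\xi$, $(x_i^*)\subset X_\xi^*$ form a $\varrho$-Schreier pair if for some $J=\{J(1)<J(2)<\cdots\}\in[\mathbb N]$: (i) $x_i^*(x_j)=0$ for $i\ne j$; (ii) $\mathrm{Re}\,x_i^*(x_i)=|x_i^*|(|x_i|)$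 for all $i$; (iii) $\inf_i\mathrm{Re}\,x_i^*(x_i)>0$; (iv) $(x_i)_i\approx(e^\varrho_{J(i)})_i$; (v) $(x_i^*)_i\approx(f^\varrho_{J(i)})_i$; (vi) $\sup_n\|\sum_{i=1}^nx_i\otimes x_i^*\|<\infty$, where $(x\otimes x^*)(y)=x^*(y)x$. **Spreading models.** A sequence $(x_i)$ in a normed space with $0<\inf_i\|x_i\|\le\sup_i\|x_i\|<\infty$ is a $C$-$\ell_1^\varrho$ spreading model if $\|\sum_{i\in E}a_ix_i\|\ge C$ whenever $E\in\mathcal S_\varrho$ and $\sum_{i\in E}|a_i|=1$, and a $C$-$c_0^\varrho$ spreading model if $\|\sum_{i\in E}a_ix_i\|\le C$ whenever $E\in\mathcal S_\varrho$ and $\max_{i\in E}|a_i|\le1$. **Repeated averages.** For $\xi<\omega_1$, $M\in[\mathbb N]$ and $n\in\mathbb N$, functions $\mathbb S^\xi_{M,n}:\mathbb N\to[0,1]$ are defined by recursion on $\xi$ and on $n$. $\mathbb S^0_{M,n}$ is the indicator function of the $n$-th smallest element of $M$. For $\xi\ge1$ let $M_n=M\setminus\bigcup_{i<n}\mathrm{supp}(\mathbb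 S^\xi_{M,i})$. If $\xi=\zeta+1$, then $\mathbb S^{\xi}_{M,n}=\frac1{\min M_n}\sum_{j=1}^{\min M_n}\mathbb S^\zeta_{M_n,j}$; if $\xi$ is a limit ordinal, then $\mathbb S^\xi_{M,n}=\mathbb S^{\xi_{m}+1}_{M_n,1}$ with $m=\min M_n$, where $(\xi_k)$ is the sequence fixed in the definition of $\mathcal S_\xi$. **Theorem.** Let $\iota\le\xi<\omega_1$ and $\varrho=\xi-\iota$. For every $L\in[\mathbb N]$ there is $M\in[L]$ such that, with $$x_i=\sum_{j}\mathbb S^\iota_{M,i}(j)\,e_j^\xi\in X_\xi,\qquad x_i^*=\sum_{j\in\mathrm{supp}(\mathbb S^\iota_{M,i})}f_j^\xi\in X_\xi^*\qquad(i\in\mathbb N),$$ the pair $((x_i)_{i=1}^\infty,(x_i^*)_{i=1}^\infty)$ is a $\varrho$-Schreier pair, $(x_i)_{i=1}^\infty$ is a $1$-$\ell_1^\varrho$ spreading model, and $(x_i^*)_{i=1}^\infty$ is a $1$-$c_0^\varrho$ spreading model. -/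

import Mathlib

open scoped Ordinal

noncomputable section

namespace SchreierSpaces

/-! ### Schreier families -/

/-- For a choice `s ξ : ℕ+ → Ordinal` of sequences of ordinals (used at limit ordinals `ξ` only),
`Family s ξ E` says that the finite set `E` of positive integers belongs to the Schreier family of
order `ξ`:
* the empty set belongs to every family, and the family of order `0` consists of it and the
  singletons;
* the nonempty members of the family of order `ξ + 1` are the unions `E_1 ∪ ⋯ ∪ E_k` of nonempty
  members of the family of order `ξ` with `k ≤ E_1 < ⋯ < E_k`;
* the nonempty members of the family of limit order `ξ` are the sets `E` for which there is
  `n ≤ min E` with `E` in the family of order `s ξ n + 1`. -/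
inductive Family (s : Ordinal.{0} → ℕ+ → Ordinal.{0}) : Ordinal.{0} → Finset ℕ+ → Prop
  | empty (ξ : Ordinal.{0}) : Family s ξ ∅
  | singleton (n : ℕ+) : Family s 0 {n}
  | succ (ξ : Ordinal.{0}) (k : ℕ+) (E : Fin k → Finset ℕ+)
      (nonempty : ∀ i, (E i).Nonempty)
      (mem : ∀ i, Family s ξ (E i))
      (le : ∀ i, ∀ a ∈ E i, k ≤ a)
      (lt : ∀ i j, i < j → ∀ a ∈ E i, ∀ b ∈ E j, a < b) :
      Family s (ξ + 1) (Finset.univ.biUnion E)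
  | limit (ξ : Ordinal.{0}) (isLimit : Order.IsSuccLimit ξ) (n : ℕ+) (E : Finset ℕ+)
      (nonempty : E.Nonempty)
      (le : ∀ a ∈ E, n ≤ a)
      (mem : Family s (s ξ n + 1) E) :
      Family s ξ E

/-- An admissible choice of sequences for the definition of the Schreier families: for every
countable limit ordinal `ξ`, a sequence `ξ_n ↑ ξ` such that the family of order `ξ_n + 1` is
contained in the family of order `ξ_{n+1}`.  (The values at uncountable limit ordinals play no
role; there it is only asked that they lie below the ordinal, so that recursions make sense.) -/
structure System where
  /-- the chosen sequences -/
  seq : Ordinal.{0} → ℕ+ → Ordinal.{0}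
  seq_lt : ∀ ξ, Order.IsSuccLimit ξ → ∀ n, seq ξ n < ξ
  strictMono : ∀ ξ < ω₁, Order.IsSuccLimit ξ → StrictMono (seq ξ)
  isLUB : ∀ ξ < ω₁, Order.IsSuccLimit ξ → IsLUB (Set.range (seq ξ)) ξ
  nested : ∀ ξ < ω₁, Order.IsSuccLimit ξ → ∀ n E,
    Family seq (seq ξ n + 1) E → Family seq (seq ξ (n + 1)) E

/-- The Schreier family of order `ξ`. -/
def schreier (c : System) (ξ : Ordinal.{0}) : Set (Finset ℕ+) := {E | Family c.seq ξ E}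

theorem empty_mem_schreier (c : System) (ξ : Ordinal.{0}) : ∅ ∈ schreier c ξ := Family.empty ξ

theorem singleton_mem_schreier (c : System) (n : ℕ+) (ξ : Ordinal.{0}) :
    {n} ∈ schreier c ξ := by
  induction ξ using Ordinal.limitRecOn with
  | zero => exact Family.singleton n
  | add_one ξ ih =>
    have h := Family.succ (s := c.seq) ξ 1 (fun _ => {n}) (fun _ => Finset.singleton_nonempty n)
      (fun _ => ih) (fun _ a _ => one_le)
      (fun i j hij => absurd hij (by
        have hi : (i : ℕ) < 1 := i.isLt
        have hj : (j : ℕ) < 1 := j.isLt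
        rw [Fin.lt_def]
        omega))
    have h2 : (Finset.univ : Finset (Fin (1 : ℕ+))).biUnion (fun _ => ({n} : Finset ℕ+)) = {n} := by
      ext a
      simp only [Finset.mem_biUnion, Finset.mem_univ, true_and, Finset.mem_singleton]
      exact ⟨fun ⟨_, h⟩ => h, fun h => ⟨⟨0, by rw [PNat.one_coe]; exact Nat.one_pos⟩, h⟩⟩
    rw [h2] at h
    exact h
  | limit ξ hξ ih =>
    exact Family.limit ξ hξ 1 {n} (Finset.singleton_nonempty n) (fun a _ => one_le)
      (ih _ (hξ.add_one_lt (c.seq_lt ξ hξ 1)))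

theorem mem_schreier_zero_iff (c : System) (E : Finset ℕ+) :
    E ∈ schreier c 0 ↔ E = ∅ ∨ ∃ n, E = {n} := by
  constructor
  · intro h
    have key : ∀ ξ E, Family c.seq ξ E → ξ = 0 → E = ∅ ∨ ∃ n, E = {n} := by
      intro ξ E h h0
      cases h with
      | empty => exact Or.inl rfl
      | singleton n => exact Or.inr ⟨n, rfl⟩
      | succ ξ => exact absurd h0 (by simp)
      | limit ξ hl => exact absurd h0 hl.ne_bot
    exact key 0 E h rfl
  · rintro (rfl | ⟨n, rfl⟩)
    · exact Family.empty 0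
    · exact Family.singleton n

theorem mem_schreier_add_one_iff (c : System) (ξ : Ordinal.{0}) (E : Finset ℕ+) :
    E ∈ schreier c (ξ + 1) ↔ E = ∅ ∨ ∃ (k : ℕ+) (F : Fin k → Finset ℕ+),
      (∀ i, (F i).Nonempty) ∧ (∀ i, F i ∈ schreier c ξ) ∧ (∀ i, ∀ a ∈ F i, k ≤ a) ∧
      (∀ i j, i < j → ∀ a ∈ F i, ∀ b ∈ F j, a < b) ∧ E = Finset.univ.biUnion F := by
  constructor
  · intro h
    have key : ∀ ζ E, Family c.seq ζ E → ζ = ξ + 1 →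
        E = ∅ ∨ ∃ (k : ℕ+) (F : Fin k → Finset ℕ+),
        (∀ i, (F i).Nonempty) ∧ (∀ i, F i ∈ schreier c ξ) ∧ (∀ i, ∀ a ∈ F i, k ≤ a) ∧
        (∀ i j, i < j → ∀ a ∈ F i, ∀ b ∈ F j, a < b) ∧ E = Finset.univ.biUnion F := by
      intro ζ E h h0
      cases h with
      | empty => exact Or.inl rfl
      | singleton n => exact absurd h0.symm (by simp)
      | succ ζ k F h1 h2 h3 h4 =>
        have h5 : ζ = ξ := by simpa using h0
        subst h5
        exact Or.inr ⟨k, F, h1, h2, h3, h4, rfl⟩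
      | limit ζ hl =>
        subst h0
        exact absurd (hl.add_one_lt (lt_add_one ξ)) (lt_irrefl _)
    exact key _ E h rfl
  · rintro (rfl | ⟨k, F, h1, h2, h3, h4, rfl⟩)
    · exact Family.empty _
    · exact Family.succ ξ k F h1 h2 h3 h4

theorem mem_schreier_limit_iff (c : System) (ξ : Ordinal.{0}) (hξ : Order.IsSuccLimit ξ)
    (E : Finset ℕ+) :
    E ∈ schreier c ξ ↔ E = ∅ ∨ E.Nonempty ∧
      ∃ n : ℕ+, (∀ a ∈ E, n ≤ a) ∧ E ∈ schreier c (c.seq ξ n + 1) := by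
  constructor
  · intro h
    change Family c.seq ξ E at h
    cases h with
    | empty => exact Or.inl rfl
    | singleton n => exact absurd rfl hξ.ne_bot
    | succ ζ => exact absurd (hξ.add_one_lt (lt_add_one ζ)) (lt_irrefl _)
    | limit _ _ n E h1 h2 h3 => exact Or.inr ⟨h1, n, h2, h3⟩
  · rintro (rfl | ⟨h1, n, h2, h3⟩)
    · exact Family.empty _
    · exact Family.limit ξ hξ n E h1 h2 h3

/-! ### Schreier spaces -/

/-- The space of finitely supported scalar sequences, to be equipped with the norm of order `ξ`. -/
def C00 (_c : System) (_ξ : Ordinal.{0}) (𝕜 : Type*) [RCLike 𝕜] : Type _ := ℕ+ →₀ 𝕜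

section

variable (c : System) (ξ : Ordinal.{0}) (𝕜 : Type*) [RCLike 𝕜]

instance : AddCommGroup (C00 c ξ 𝕜) := inferInstanceAs (AddCommGroup (ℕ+ →₀ 𝕜))

instance : Module 𝕜 (C00 c ξ 𝕜) := inferInstanceAs (Module 𝕜 (ℕ+ →₀ 𝕜))

/-- The identification of `C00 c ξ 𝕜` with the finitely supported functions. -/
def C00.of : (ℕ+ →₀ 𝕜) ≃ₗ[𝕜] C00 c ξ 𝕜 := LinearEquiv.refl 𝕜 (ℕ+ →₀ 𝕜)

instance : FunLike (C00 c ξ 𝕜) ℕ+ 𝕜 := inferInstanceAs (FunLike (ℕ+ →₀ 𝕜) ℕ+ 𝕜)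

/-- `‖x‖ = sup {∑_{i ∈ E} |x_i| : E ∈ S_ξ}`. -/
instance : Norm (C00 c ξ 𝕜) := ⟨fun x => ⨆ E : schreier c ξ, ∑ i ∈ E.1, ‖x i‖⟩

end

section

variable {c : System} {ξ : Ordinal.{0}} {𝕜 : Type*} [RCLike 𝕜]

theorem C00.norm_def (x : C00 c ξ 𝕜) : ‖x‖ = ⨆ E : schreier c ξ, ∑ i ∈ E.1, ‖x i‖ := rfl

theorem C00.of_apply (x : ℕ+ →₀ 𝕜) (i : ℕ+) : C00.of c ξ 𝕜 x i = x i := rfl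

theorem C00.of_symm_apply (x : C00 c ξ 𝕜) (i : ℕ+) : (C00.of c ξ 𝕜).symm x i = x i := rfl

theorem C00.add_apply (x y : C00 c ξ 𝕜) (i : ℕ+) : (x + y) i = x i + y i := rfl

theorem C00.smul_apply (a : 𝕜) (x : C00 c ξ 𝕜) (i : ℕ+) : (a • x) i = a * x i := rfl

theorem C00.bddAbove (x : C00 c ξ 𝕜) :
    BddAbove (Set.range fun E : schreier c ξ => ∑ i ∈ E.1, ‖x i‖) := by
  classical
  refine ⟨∑ i ∈ ((C00.of c ξ 𝕜).symm x).support, ‖x i‖, ?_⟩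
  rintro _ ⟨E, rfl⟩
  have h1 : ∑ i ∈ E.1 with x i ≠ 0, ‖x i‖ = ∑ i ∈ E.1, ‖x i‖ := by
    refine Finset.sum_filter_of_ne fun i _ hi h => hi ?_
    rw [h, norm_zero]
  refine h1.symm.le.trans (Finset.sum_le_sum_of_subset_of_nonneg (fun i hi => ?_)
    fun _ _ _ => norm_nonneg _)
  rw [Finsupp.mem_support_iff, C00.of_symm_apply]
  exact (Finset.mem_filter.1 hi).2

theorem C00.sum_le_norm (x : C00 c ξ 𝕜) {E : Finset ℕ+} (hE : E ∈ schreier c ξ) :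
    ∑ i ∈ E, ‖x i‖ ≤ ‖x‖ :=
  le_ciSup (C00.bddAbove x) ⟨E, hE⟩

theorem C00.norm_le {x : C00 c ξ 𝕜} {C : ℝ} (h : ∀ E ∈ schreier c ξ, ∑ i ∈ E, ‖x i‖ ≤ C) :
    ‖x‖ ≤ C :=
  haveI : Nonempty (schreier c ξ) := ⟨⟨∅, empty_mem_schreier c ξ⟩⟩
  ciSup_le fun E => h E.1 E.2

theorem C00.norm_apply_le (x : C00 c ξ 𝕜) (j : ℕ+) : ‖x j‖ ≤ ‖x‖ := by
  simpa using C00.sum_le_norm x (singleton_mem_schreier c j ξ)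

theorem C00.core (c : System) (ξ : Ordinal.{0}) (𝕜 : Type*) [RCLike 𝕜] :
    NormedSpace.Core 𝕜 (C00 c ξ 𝕜) where
  norm_nonneg x := (norm_nonneg (x 1)).trans (C00.norm_apply_le x 1)
  norm_smul a x := by
    rw [C00.norm_def, C00.norm_def, Real.mul_iSup_of_nonneg (norm_nonneg a)]
    refine iSup_congr fun E => ?_
    rw [Finset.mul_sum]
    exact Finset.sum_congr rfl fun i _ => by rw [C00.smul_apply, norm_mul]
  norm_triangle x y := C00.norm_le fun E hE => by
    refine le_trans ?_ (add_le_add (C00.sum_le_norm x hE) (C00.sum_le_norm y hE))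
    rw [← Finset.sum_add_distrib]
    exact Finset.sum_le_sum fun i _ => by rw [C00.add_apply]; exact norm_add_le _ _
  norm_eq_zero_iff x := by
    constructor
    · intro h
      refine Finsupp.ext fun j => ?_
      have h1 := C00.norm_apply_le x j
      rw [h] at h1
      exact norm_le_zero_iff.1 h1
    · rintro rfl
      refine le_antisymm (C00.norm_le fun E _ => ?_)
        ((norm_nonneg ((0 : C00 c ξ 𝕜) 1)).trans (C00.norm_apply_le 0 1))
      refine (Finset.sum_eq_zero fun i _ => ?_).le
      exact norm_zero

end

section

variable (c : System) (ξ : Ordinal.{0}) (𝕜 : Type*) [RCLike 𝕜]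

instance : NormedAddCommGroup (C00 c ξ 𝕜) := NormedAddCommGroup.ofCore (C00.core c ξ 𝕜)

instance : NormedSpace 𝕜 (C00 c ξ 𝕜) := NormedSpace.ofCore (C00.core c ξ 𝕜)

/-- The Schreier space `X_ξ` over `𝕜`: the completion of `c_00` in the norm of order `ξ`. -/
abbrev Space : Type _ := UniformSpace.Completion (C00 c ξ 𝕜)

/-- The canonical basis vector `e_j` of `X_ξ`. -/
def e (j : ℕ+) : Space c ξ 𝕜 :=
  ((C00.of c ξ 𝕜 (Finsupp.single j 1) : C00 c ξ 𝕜) : UniformSpace.Completion (C00 c ξ 𝕜))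

end

section

variable {c : System} {ξ : Ordinal.{0}} {𝕜 : Type*} [RCLike 𝕜]

/-- The continuous extension to `X_ξ` of a bounded linear functional on `c_00`. -/
def extendFunctional (φ : StrongDual 𝕜 (C00 c ξ 𝕜)) : StrongDual 𝕜 (Space c ξ 𝕜) :=
  ContinuousLinearMap.extend φ UniformSpace.Completion.toComplL

theorem extendFunctional_coe (φ : StrongDual 𝕜 (C00 c ξ 𝕜)) (x : C00 c ξ 𝕜) :
    extendFunctional φ (x : Space c ξ 𝕜) = φ x :=
  ContinuousLinearMap.extend_eq φ UniformSpace.Completion.denseRange_coe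
    (UniformSpace.Completion.isUniformInducing_coe _) x

variable (c ξ 𝕜) in
/-- The coordinate functional `f_j` in the dual of `X_ξ`. -/
def f (j : ℕ+) : StrongDual 𝕜 (Space c ξ 𝕜) :=
  extendFunctional (LinearMap.mkContinuous
    { toFun := fun x : C00 c ξ 𝕜 => x j
      map_add' := fun x y => C00.add_apply x y j
      map_smul' := fun a x => C00.smul_apply a x j } 1
    fun x => by rw [one_mul]; exact C00.norm_apply_le x j)

theorem f_coe (j : ℕ+) (x : C00 c ξ 𝕜) : f c ξ 𝕜 j (x : Space c ξ 𝕜) = x j :=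
  extendFunctional_coe _ x

theorem f_e (i j : ℕ+) : f c ξ 𝕜 i (e c ξ 𝕜 j) = if i = j then 1 else 0 := by
  rw [e, f_coe, C00.of_apply, Finsupp.single_apply]
  simp only [eq_comm]

/-- The coordinatewise modulus on `c_00`. -/
def C00.modulus (x : C00 c ξ 𝕜) : C00 c ξ 𝕜 :=
  C00.of c ξ 𝕜 (((C00.of c ξ 𝕜).symm x).mapRange (fun z : 𝕜 => ((‖z‖ : ℝ) : 𝕜)) (by simp))

theorem C00.modulus_apply (x : C00 c ξ 𝕜) (j : ℕ+) : C00.modulus x j = ((‖x j‖ : ℝ) : 𝕜) :=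
  Finsupp.mapRange_apply (hf := by simp) ..

theorem C00.uniformContinuous_modulus :
    UniformContinuous (C00.modulus : C00 c ξ 𝕜 → C00 c ξ 𝕜) := by
  refine LipschitzWith.uniformContinuous (K := 1) (LipschitzWith.of_dist_le_mul fun x y => ?_)
  rw [dist_eq_norm, dist_eq_norm, NNReal.coe_one, one_mul]
  refine C00.norm_le fun E hE => le_trans (Finset.sum_le_sum fun i _ => ?_)
    (C00.sum_le_norm (x - y) hE)
  change ‖C00.modulus x i - C00.modulus y i‖ ≤ ‖x i - y i‖
  rw [C00.modulus_apply, C00.modulus_apply, ← RCLike.ofReal_sub, RCLike.norm_ofReal]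
  exact abs_norm_sub_norm_le _ _

/-- The modulus `|x|` of an element of the lattice `X_ξ`: the continuous extension of the
coordinatewise modulus. -/
def modulus (x : Space c ξ 𝕜) : Space c ξ 𝕜 :=
  UniformSpace.Completion.map (C00.modulus : C00 c ξ 𝕜 → C00 c ξ 𝕜) x

theorem f_modulus (j : ℕ+) (x : Space c ξ 𝕜) :
    f c ξ 𝕜 j (modulus x) = ((‖f c ξ 𝕜 j x‖ : ℝ) : 𝕜) := by
  induction x using UniformSpace.Completion.induction_on with
  | hp =>
    refine isClosed_eq ((f c ξ 𝕜 j).continuous.comp UniformSpace.Completion.continuous_map) ?_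
    exact RCLike.continuous_ofReal.comp (f c ξ 𝕜 j).continuous.norm
  | ih x =>
    rw [modulus, UniformSpace.Completion.map_coe C00.uniformContinuous_modulus, f_coe, f_coe,
      C00.modulus_apply]

theorem coe_eq_sum (x : C00 c ξ 𝕜) :
    (x : Space c ξ 𝕜) = ((C00.of c ξ 𝕜).symm x).sum fun j a => a • e c ξ 𝕜 j := by
  obtain ⟨x, rfl⟩ := (C00.of c ξ 𝕜).surjective x
  rw [LinearEquiv.symm_apply_apply]
  induction x using Finsupp.induction_linear with
  | zero => rw [map_zero, Finsupp.sum_zero_index, UniformSpace.Completion.coe_zero]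
  | add x y hx hy =>
    rw [map_add, UniformSpace.Completion.coe_add, hx, hy]
    exact (Finsupp.sum_add_index' (h := fun j a => a • e c ξ 𝕜 j) (fun j => zero_smul 𝕜 _)
      fun j a b => add_smul a b _).symm
  | single j a =>
    rw [Finsupp.sum_single_index (h := fun j a => a • e c ξ 𝕜 j) (zero_smul 𝕜 _), e, ← UniformSpace.Completion.coe_smul,
      ← map_smul, Finsupp.smul_single, smul_eq_mul, mul_one]

theorem sum_norm_apply_le (φ : StrongDual 𝕜 (Space c ξ 𝕜)) (x : C00 c ξ 𝕜) :
    ‖((C00.of c ξ 𝕜).symm x).sum fun j a => a * ((‖φ (e c ξ 𝕜 j)‖ : ℝ) : 𝕜)‖ ≤ ‖φ‖ * ‖x‖ := by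
  have hu : ∀ z : 𝕜, ∃ u : 𝕜, ‖u‖ ≤ 1 ∧ u * z = ((‖z‖ : ℝ) : 𝕜) := by
    intro z
    by_cases hz : z = 0
    · exact ⟨0, by simp, by simp [hz]⟩
    · refine ⟨((‖z‖ : ℝ) : 𝕜) / z, ?_, div_mul_cancel₀ _ hz⟩
      rw [norm_div, RCLike.norm_ofReal, abs_norm]
      exact div_self_le_one _
  choose u hu1 hu2 using hu
  let y : C00 c ξ 𝕜 := C00.of c ξ 𝕜 (Finsupp.onFinset ((C00.of c ξ 𝕜).symm x).support
    (fun j => x j * u (φ (e c ξ 𝕜 j)))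
    (fun j h => Finsupp.mem_support_iff.2 fun h' => h (by
      rw [C00.of_symm_apply] at h'
      rw [h', zero_mul])))
  have hy : ∀ j, y j = x j * u (φ (e c ξ 𝕜 j)) := fun j => rfl
  have hyx : ‖y‖ ≤ ‖x‖ := C00.norm_le fun E hE => by
    refine le_trans (Finset.sum_le_sum fun i _ => ?_) (C00.sum_le_norm x hE)
    rw [hy, norm_mul]
    exact mul_le_of_le_one_right (norm_nonneg _) (hu1 _)
  have hφ : φ (y : Space c ξ 𝕜) =
      ((C00.of c ξ 𝕜).symm x).sum fun j a => a * ((‖φ (e c ξ 𝕜 j)‖ : ℝ) : 𝕜) := by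
    rw [coe_eq_sum, map_finsuppSum, LinearEquiv.symm_apply_apply]
    refine (Finsupp.onFinset_sum _ fun j => by simp).trans ?_
    refine Finset.sum_congr rfl fun j _ => ?_
    rw [map_smul, smul_eq_mul, mul_assoc, hu2]
    rfl
  rw [← hφ]
  refine (φ.le_opNorm _).trans ?_
  rw [UniformSpace.Completion.norm_coe]
  exact mul_le_mul_of_nonneg_left hyx (norm_nonneg _)

/-- The modulus `|x*|` of a functional on `X_ξ`: the functional with values `|x*(e_j)|` at the
basis vectors. -/
def dualModulus (φ : StrongDual 𝕜 (Space c ξ 𝕜)) : StrongDual 𝕜 (Space c ξ 𝕜) :=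
  extendFunctional (LinearMap.mkContinuous
    { toFun := fun x : C00 c ξ 𝕜 =>
        ((C00.of c ξ 𝕜).symm x).sum fun j a => a * ((‖φ (e c ξ 𝕜 j)‖ : ℝ) : 𝕜)
      map_add' := fun x y => by
        rw [map_add]
        exact Finsupp.sum_add_index' (by simp) (by intros; ring)
      map_smul' := fun a x => by
        rw [RingHom.id_apply, smul_eq_mul, Finsupp.mul_sum, map_smul]
        refine (Finsupp.sum_smul_index (by simp)).trans ?_
        exact Finset.sum_congr rfl fun i _ => mul_assoc _ _ _ } ‖φ‖
    (sum_norm_apply_le φ))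

theorem dualModulus_e (φ : StrongDual 𝕜 (Space c ξ 𝕜)) (j : ℕ+) :
    dualModulus φ (e c ξ 𝕜 j) = ((‖φ (e c ξ 𝕜 j)‖ : ℝ) : 𝕜) := by
  refine (extendFunctional_coe _ (C00.of c ξ 𝕜 (Finsupp.single j 1))).trans ?_
  change ((C00.of c ξ 𝕜).symm (C00.of c ξ 𝕜 (Finsupp.single j 1))).sum
    (fun j a => a * ((‖φ (e c ξ 𝕜 j)‖ : ℝ) : 𝕜)) = _
  rw [LinearEquiv.symm_apply_apply, Finsupp.sum_single_index (by simp), one_mul]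

end

/-! ### Sequences in normed spaces -/

section

variable {𝕜 : Type*} [RCLike 𝕜] {V W : Type*} [NormedAddCommGroup V] [NormedSpace 𝕜 V]
  [NormedAddCommGroup W] [NormedSpace 𝕜 W]

variable (𝕜) in
/-- `x` is a block sequence with respect to `b`: nonzero vectors in the spans of the
`b_j`, `j ∈ E_i`, for finite sets `E_1 < E_2 < ⋯`. -/
def IsBlockSequence (b x : ℕ+ → V) : Prop :=
  ∃ E : ℕ+ → Finset ℕ+, (∀ i j, i < j → ∀ a ∈ E i, ∀ b ∈ E j, a < b) ∧
    ∀ i, x i ≠ 0 ∧ x i ∈ Submodule.span 𝕜 (b '' (E i : Set ℕ+))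

variable (𝕜) in
/-- `y` dominates `x` with constant `C`. -/
def IsDominatedWith (C : ℝ) (x : ℕ+ → V) (y : ℕ+ → W) : Prop :=
  ∀ a : ℕ+ →₀ 𝕜, ‖a.sum fun i t => t • x i‖ ≤ C * ‖a.sum fun i t => t • y i‖

variable (𝕜) in
/-- `x` and `y` are equivalent sequences: each dominates the other. -/
def IsEquivalent (x : ℕ+ → V) (y : ℕ+ → W) : Prop :=
  (∃ C : ℝ, IsDominatedWith 𝕜 C x y) ∧ ∃ C : ℝ, IsDominatedWith 𝕜 C y x

/-- `0 < inf ‖x_i‖` and `sup ‖x_i‖ < ∞`. -/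
def IsSeminormalized (x : ℕ+ → V) : Prop :=
  ∃ δ C : ℝ, 0 < δ ∧ ∀ i, δ ≤ ‖x i‖ ∧ ‖x i‖ ≤ C

variable (𝕜) in
/-- `x` is a `C`-`ℓ_1` spreading model of order `ϱ`. -/
def IsEllOneSpreadingModel (c : System) (ϱ : Ordinal.{0}) (C : ℝ) (x : ℕ+ → V) : Prop :=
  IsSeminormalized x ∧ ∀ E ∈ schreier c ϱ, ∀ a : ℕ+ → 𝕜, ∑ i ∈ E, ‖a i‖ = 1 →
    C ≤ ‖∑ i ∈ E, a i • x i‖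

variable (𝕜) in
/-- `x` is a `C`-`c_0` spreading model of order `ϱ`. -/
def IsCZeroSpreadingModel (c : System) (ϱ : Ordinal.{0}) (C : ℝ) (x : ℕ+ → V) : Prop :=
  IsSeminormalized x ∧ ∀ E ∈ schreier c ϱ, ∀ a : ℕ+ → 𝕜, (∀ i ∈ E, ‖a i‖ ≤ 1) →
    ‖∑ i ∈ E, a i • x i‖ ≤ C

end

/-! ### Schreier pairs -/

/-- The normalized block sequences `x` in `X_ξ` and `x'` in its dual form a `ϱ`-Schreier pair. -/
structure IsSchreierPair {c : System} {ξ : Ordinal.{0}} {𝕜 : Type*} [RCLike 𝕜]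
    (ϱ : Ordinal.{0}) (x : ℕ+ → Space c ξ 𝕜) (x' : ℕ+ → StrongDual 𝕜 (Space c ξ 𝕜)) : Prop where
  block : IsBlockSequence 𝕜 (e c ξ 𝕜) x
  normalized : ∀ i, ‖x i‖ = 1
  dual_block : IsBlockSequence 𝕜 (f c ξ 𝕜) x'
  dual_normalized : ∀ i, ‖x' i‖ = 1
  biorthogonal : ∀ i j, i ≠ j → x' i (x j) = 0
  modulus_eq : ∀ i, ((RCLike.re (x' i (x i)) : ℝ) : 𝕜) = dualModulus (x' i) (modulus (x i))
  inf_pos : ∃ δ : ℝ, 0 < δ ∧ ∀ i, δ ≤ RCLike.re (x' i (x i))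
  equivalent : ∃ J : ℕ+ → ℕ+, StrictMono J ∧
    IsEquivalent 𝕜 x (fun i => e c ϱ 𝕜 (J i)) ∧
    IsEquivalent 𝕜 x' (fun i => f c ϱ 𝕜 (J i))
  bounded : ∃ C : ℝ, ∀ n : ℕ+, ‖∑ i ∈ Finset.Icc 1 n, (x' i).smulRight (x i)‖ ≤ C

/-! ### Repeated averages -/

/-- The least element of a nonempty set of positive integers (`1` for the empty set). -/
def least (M : Set ℕ+) : ℕ+ :=
  open Classical in if h : M.Nonempty then WellFounded.min wellFounded_lt M h else 1

/-- Given a rule `first` that attaches a finitely supported function to each set `N`, remove from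
`M` the support of `first M`, then from what is left, say `N`, the support of `first N`, and so on,
`n` times altogether. -/
def remainder (first : Set ℕ+ → ℕ+ →₀ ℝ) (M : Set ℕ+) : ℕ → Set ℕ+
  | 0 => M
  | n + 1 => remainder first M n \ (first (remainder first M n)).support

/-- The sequence `first M_1, first M_2, …`, where `M_1 = M` and
`M_{n+1} = M_n \ supp (first M_n)`. -/
def successive (first : Set ℕ+ → ℕ+ →₀ ℝ) (M : Set ℕ+) (n : ℕ+) : ℕ+ →₀ ℝ :=
  first (remainder first M n.natPred)

/-- The first repeated average of order `ξ` on `M`. -/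
def firstAverage (c : System) (ξ : Ordinal.{0}) : Set ℕ+ → ℕ+ →₀ ℝ :=
  Ordinal.limitRecOn (motive := fun _ => Set ℕ+ → ℕ+ →₀ ℝ) ξ
    (fun M => Finsupp.single (least M) 1)
    (fun _ A M => (1 / ((least M : ℕ) : ℝ)) • ∑ j ∈ Finset.Icc 1 (least M), successive A M j)
    (fun ζ hζ A M => A (c.seq ζ (least M) + 1) (hζ.add_one_lt (c.seq_lt ζ hζ _)) M)

/-- The repeated average of order `ξ` with index `n` on `M`. -/
def average (c : System) (ξ : Ordinal.{0}) (M : Set ℕ+) (n : ℕ+) : ℕ+ →₀ ℝ :=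
  successive (firstAverage c ξ) M n

/-- `M_n = M \ ⋃_{i < n} supp (average M i)`. -/
def rest (c : System) (ξ : Ordinal.{0}) (M : Set ℕ+) (n : ℕ+) : Set ℕ+ :=
  M \ ⋃ i : ℕ+, ⋃ _ : i < n, ((average c ξ M i).support : Set ℕ+)

theorem remainder_eq_rest (c : System) (ξ : Ordinal.{0}) (M : Set ℕ+) (n : ℕ+) :
    remainder (firstAverage c ξ) M n.natPred = rest c ξ M n := by
  induction n using PNat.recOn with
  | one =>
    ext a
    have h1 : PNat.natPred 1 = 0 := rfl
    simp [h1, remainder, rest]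
  | succ n ih =>
    have h1 : (n + 1).natPred = n.natPred + 1 := by
      have := n.pos
      simp only [PNat.natPred, PNat.add_coe, PNat.one_coe]
      omega
    rw [h1, remainder, ih]
    have h2 : firstAverage c ξ (rest c ξ M n) = average c ξ M n := by
      rw [average, successive, ih]
    rw [h2]
    ext a
    simp only [rest, Set.mem_sdiff, Set.mem_iUnion, not_exists, PNat.lt_add_one_iff]
    constructor
    · rintro ⟨⟨h3, h4⟩, h5⟩
      refine ⟨h3, fun i hi => ?_⟩
      rcases hi.lt_or_eq with hi | rfl
      · exact h4 i hi
      · exact h5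
    · rintro ⟨h3, h4⟩
      exact ⟨⟨h3, fun i hi => h4 i hi.le⟩, h4 n le_rfl⟩

theorem average_zero (c : System) (M : Set ℕ+) (n : ℕ+) :
    average c 0 M n = Finsupp.single (least (rest c 0 M n)) 1 := by
  rw [average, successive, remainder_eq_rest, firstAverage, Ordinal.limitRecOn_zero]

theorem average_add_one (c : System) (ξ : Ordinal.{0}) (M : Set ℕ+) (n : ℕ+) :
    average c (ξ + 1) M n = (1 / ((least (rest c (ξ + 1) M n) : ℕ) : ℝ)) •
      ∑ j ∈ Finset.Icc 1 (least (rest c (ξ + 1) M n)), average c ξ (rest c (ξ + 1) M n) j := by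
  rw [average, successive, remainder_eq_rest, firstAverage, Ordinal.limitRecOn_add_one]
  rfl

theorem average_limit (c : System) (ξ : Ordinal.{0}) (hξ : Order.IsSuccLimit ξ) (M : Set ℕ+)
    (n : ℕ+) :
    average c ξ M n =
      average c (c.seq ξ (least (rest c ξ M n)) + 1) (rest c ξ M n) 1 := by
  rw [average, successive, remainder_eq_rest, firstAverage, Ordinal.limitRecOn_limit _ _ _ _ hξ]
  rfl

/-- The vectors `x_i = ∑_j S(j) e_j` in `X_ξ`, where `S` is the repeated average of order `ι` with
index `i` on `M`. -/
def averageVector (c : System) (ξ : Ordinal.{0}) (𝕜 : Type*) [RCLike 𝕜] (ι : Ordinal.{0})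
    (M : Set ℕ+) (i : ℕ+) : Space c ξ 𝕜 :=
  (average c ι M i).sum fun j t => (t : 𝕜) • e c ξ 𝕜 j

/-- The functionals `x_i* = ∑_{j ∈ supp S} f_j` on `X_ξ`, where `S` is the repeated average of
order `ι` with index `i` on `M`. -/
def supportFunctional (c : System) (ξ : Ordinal.{0}) (𝕜 : Type*) [RCLike 𝕜] (ι : Ordinal.{0})
    (M : Set ℕ+) (i : ℕ+) : StrongDual 𝕜 (Space c ξ 𝕜) :=
  ∑ j ∈ (average c ι M i).support, f c ξ 𝕜 j

end SchreierSpaces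

end

namespace SchreierSpaces

/-! Put `ρ = ξ - ι`. The averages live on successive blocks of `M`, and the whole statement is read
off from two operators. The collapse `V : X_ξ → X_ρ` sends `e_j` to `e_{J(i)}` for `j` in block `i`
and kills the other basis vectors; `U : X_ρ → X_ξ` sends `e_{J(i)}` to `x_i` and kills the other
basis vectors. Since each average is a probability on its block, `V x_i = e_{J(i)}`, and dually
`x_i* = f_{J(i)} ∘ V` and `x_i* ∘ U = f_{J(i)}`. Once `‖V‖ ≤ 1` and `‖U‖ ≤ 3` are known, the
equivalences, the bounded partial sums and the isometric spreading model estimates are formal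
(`isSchreierPair_of_operators`).

That `V` is a contraction means that for `E ∈ S_ρ` the union of the blocks with index `J(i) ∈ E`
lies in `S_{ι+ρ}`. Each block is in `S_ι`, and `exists_union_mem_schreier_add` supplies a function
`T` such that `T(J(i)) ≤ a` for all `a` in block `i` is enough.

For `U`, `exists_decomposition_of_mem_schreier_add` cuts `G ∈ S_{ι+ρ}` into pieces in `S_ι` whose
minima, moved to the right by `Φ`, form a set in `S_ρ`. In `exists_mass_le` the pieces are compared
with the blocks. Blocks that contain a minimum and have one before them have indices forming a set
in `S_ρ`. A block with a minimum before it and none inside meets a single piece, which starts before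
the block; by `sum_firstAverage_le` and sparseness of `M` its mass is geometrically small. At most
one block met by `G` has no minimum before it. Each of the three contributions is at most the norm.

Both requirements are met by letting `J(i)` be `Φ` of the last point of the preceding block, in a
sufficiently sparse `M`. -/

variable {c : System}

/-! ### Schreier families: colourings, spreading and inclusions. -/

/-- A set is in the family of order `ξ + 1` as soon as it can be coloured monotonically, with
at most `min E` colours, such that the colour classes are in the family of order `ξ`. -/
theorem mem_schreier_add_one_of_coloring {ξ : Ordinal.{0}} {E : Finset ℕ+} (φ : ℕ+ → ℕ) (k : ℕ)
    (hmono : MonotoneOn φ E) (hlt : ∀ a ∈ E, φ a < k) (hk : ∀ a ∈ E, k ≤ (a : ℕ))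
    (hf : ∀ i, {a ∈ E | φ a = i} ∈ schreier c ξ) : E ∈ schreier c (ξ + 1) := by
  classical
  rcases E.eq_empty_or_nonempty with rfl | hE
  · exact empty_mem_schreier c _
  have hI : (E.image φ).Nonempty := hE.image φ
  have hr : (E.image φ).card ≤ k := by
    refine (Finset.card_le_card (t := Finset.range k) fun i hi => ?_).trans_eq
      (Finset.card_range k)
    obtain ⟨a, ha, rfl⟩ := Finset.mem_image.1 hi
    exact Finset.mem_range.2 (hlt a ha)
  -- Unused colours are dropped and the rest renumbered increasingly, so that all parts are
  -- nonempty; at most `k` remain.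
  set o := (E.image φ).orderEmbOfFin rfl with ho
  rw [mem_schreier_add_one_iff]
  refine Or.inr ⟨⟨(E.image φ).card, hI.card_pos⟩, fun i => {a ∈ E | φ a = o i}, fun i => ?_,
    fun i => hf _, fun i a ha => ?_, fun i j hij a ha b hb => ?_, ?_⟩
  · obtain ⟨a, ha, h⟩ := Finset.mem_image.1 ((E.image φ).orderEmbOfFin_mem rfl i)
    exact ⟨a, Finset.mem_filter.2 ⟨ha, h⟩⟩
  · exact (PNat.coe_le_coe _ _).1 (hr.trans (hk a (Finset.mem_filter.1 ha).1))
  · rw [Finset.mem_filter] at ha hb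
    by_contra! h
    have h1 := hmono hb.1 ha.1 h
    rw [ha.2, hb.2] at h1
    exact absurd (o.lt_iff_lt.2 hij) h1.not_gt
  · ext a
    simp only [Finset.mem_biUnion, Finset.mem_univ, true_and, Finset.mem_filter]
    constructor
    · intro ha
      have h1 : φ a ∈ Set.range o := by
        rw [ho, Finset.range_orderEmbOfFin]
        exact Finset.mem_image_of_mem _ ha
      obtain ⟨i, hi⟩ := h1
      exact ⟨i, ha, hi.symm⟩
    · rintro ⟨_, h, _⟩
      exact h

/-- Converse of `mem_schreier_add_one_of_coloring`. Colourings pull back along monotone maps and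
restrict to subsets, which makes the successor steps below short. -/
theorem exists_coloring_of_mem_schreier_add_one {ξ : Ordinal.{0}} {E : Finset ℕ+}
    (hE : E ∈ schreier c (ξ + 1)) : ∃ (φ : ℕ+ → ℕ) (k : ℕ), MonotoneOn φ E ∧
      (∀ a ∈ E, φ a < k) ∧ (∀ a ∈ E, k ≤ (a : ℕ)) ∧ ∀ i, {a ∈ E | φ a = i} ∈ schreier c ξ := by
  classical
  rw [mem_schreier_add_one_iff] at hE
  obtain rfl | ⟨k, F, -, h2, h3, h4, rfl⟩ := hE
  · exact ⟨fun _ => 0, 0, by simp [MonotoneOn], by simp, by simp,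
      fun i => by simpa using empty_mem_schreier c ξ⟩
  have huniq : ∀ a i j, a ∈ F i → a ∈ F j → i = j := by
    intro a i j hi hj
    rcases lt_trichotomy i j with h | h | h
    · exact absurd (h4 i j h a hi a hj) (lt_irrefl a)
    · exact h
    · exact absurd (h4 j i h a hj a hi) (lt_irrefl a)
  let φ : ℕ+ → ℕ := fun a => if h : ∃ i, a ∈ F i then (h.choose : ℕ) else 0
  have hφ : ∀ i, ∀ a ∈ F i, φ a = i := by
    intro i a ha
    have h : ∃ i, a ∈ F i := ⟨i, ha⟩
    simp only [φ, dif_pos h]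
    rw [huniq a _ _ h.choose_spec ha]
  refine ⟨φ, k, ?_, ?_, ?_, ?_⟩
  · intro a ha b hb hab
    simp only [Finset.coe_biUnion, Set.mem_iUnion, Finset.mem_coe] at ha hb
    obtain ⟨i, -, ha⟩ := ha
    obtain ⟨j, -, hb⟩ := hb
    rw [hφ i a ha, hφ j b hb]
    by_contra! h
    exact absurd (h4 j i h b hb a ha) hab.not_gt
  · intro a ha
    obtain ⟨i, -, ha⟩ := Finset.mem_biUnion.1 ha
    rw [hφ i a ha]
    exact i.isLt
  · intro a ha
    obtain ⟨i, -, ha⟩ := Finset.mem_biUnion.1 ha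
    exact h3 i a ha
  · intro i
    by_cases hi : i < k
    · have : {a ∈ Finset.univ.biUnion F | φ a = i} = F ⟨i, hi⟩ := by
        ext a
        simp only [Finset.mem_filter, Finset.mem_biUnion, Finset.mem_univ, true_and]
        constructor
        · rintro ⟨⟨j, hj⟩, h⟩
          rw [hφ j a hj] at h
          have : j = ⟨i, hi⟩ := Fin.ext h
          rwa [← this]
        · intro h
          exact ⟨⟨_, h⟩, hφ _ a h⟩
      rw [this]
      exact h2 _
    · have : {a ∈ Finset.univ.biUnion F | φ a = i} = ∅ := by
        refine Finset.filter_eq_empty_iff.2 fun a ha h => hi ?_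
        obtain ⟨j, -, hj⟩ := Finset.mem_biUnion.1 ha
        rw [← h, hφ j a hj]
        exact j.isLt
      rw [this]
      exact empty_mem_schreier c ξ

/-- The Schreier families are spreading and hereditary. -/
theorem mem_schreier_of_spread (ξ : Ordinal.{0}) {E H : Finset ℕ+} (hE : E ∈ schreier c ξ)
    (g : ℕ+ → ℕ+) (hg : StrictMonoOn g H) (hgE : ∀ a ∈ H, g a ∈ E) (hle : ∀ a ∈ H, g a ≤ a) :
    H ∈ schreier c ξ := by
  classical
  induction ξ using Ordinal.limitRecOn generalizing E H with
  | zero =>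
    rw [mem_schreier_zero_iff] at hE ⊢
    rcases H.eq_empty_or_nonempty with h | ⟨b, hb⟩
    · exact Or.inl h
    refine Or.inr ⟨b, Finset.eq_singleton_iff_unique_mem.2 ⟨hb, fun a ha => ?_⟩⟩
    refine hg.injOn ha hb ?_
    obtain rfl | ⟨n, rfl⟩ := hE
    · exact absurd (hgE a ha) (Finset.notMem_empty _)
    · rw [Finset.mem_singleton.1 (hgE a ha), Finset.mem_singleton.1 (hgE b hb)]
  | add_one ξ ih =>
    obtain ⟨φ, k, h1, h2, h3, h4⟩ := exists_coloring_of_mem_schreier_add_one hE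
    refine mem_schreier_add_one_of_coloring (φ ∘ g) k
      (fun a ha b hb hab => h1 (hgE a ha) (hgE b hb) (hg.monotoneOn ha hb hab))
      (fun a ha => h2 _ (hgE a ha)) (fun a ha => (h3 _ (hgE a ha)).trans (hle a ha)) fun i => ?_
    refine ih (h4 i) (hg.mono fun a ha => (Finset.mem_filter.1 ha).1) (fun a ha => ?_)
      fun a ha => hle a (Finset.mem_filter.1 ha).1
    rw [Finset.mem_filter] at ha ⊢
    exact ⟨hgE a ha.1, ha.2⟩
  | limit ξ hξ ih =>
    rcases H.eq_empty_or_nonempty with rfl | hH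
    · exact empty_mem_schreier c ξ
    rw [mem_schreier_limit_iff c ξ hξ] at hE ⊢
    obtain rfl | ⟨-, n, h1, h2⟩ := hE
    · obtain ⟨b, hb⟩ := hH
      exact absurd (hgE b hb) (Finset.notMem_empty _)
    · exact Or.inr ⟨hH, n, fun a ha => (h1 _ (hgE a ha)).trans (hle a ha),
        ih _ (hξ.add_one_lt (c.seq_lt ξ hξ n)) h2 hg hgE hle⟩

theorem mem_schreier_of_subset {ξ : Ordinal.{0}} {E H : Finset ℕ+} (hE : E ∈ schreier c ξ)
    (h : H ⊆ E) : H ∈ schreier c ξ :=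
  mem_schreier_of_spread ξ hE id (strictMono_id.strictMonoOn _) (fun _ ha => h ha)
    fun _ _ => le_rfl

/-- Spreading in the form used later: the map `Φ ∘ Ψ⁻¹` is increasing on the second image and moves
no point up. -/
theorem image_mem_schreier {α : Type*} [LinearOrder α] [Nonempty α] {ξ : Ordinal.{0}}
    {E : Finset α} {Φ Ψ : α → ℕ+} (hE : E.image Φ ∈ schreier c ξ)
    (hΦ : StrictMonoOn Φ E) (hΨ : StrictMonoOn Ψ E)
    (h : ∀ a ∈ E, Φ a ≤ Ψ a) : E.image Ψ ∈ schreier c ξ := by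
  classical
  have hinv : ∀ a ∈ E, Φ (Function.invFunOn Ψ E (Ψ a)) = Φ a := fun a ha => by
    rw [hΨ.injOn.leftInvOn_invFunOn ha]
  refine mem_schreier_of_spread ξ hE (fun b => Φ (Function.invFunOn Ψ E b)) ?_ ?_ ?_
  · intro x hx y hy hxy
    obtain ⟨a, ha, rfl⟩ := Finset.mem_image.1 hx
    obtain ⟨b, hb, rfl⟩ := Finset.mem_image.1 hy
    change Φ _ < Φ _
    rw [hinv a ha, hinv b hb]
    exact hΦ ha hb ((hΨ.lt_iff_lt ha hb).1 hxy)
  · intro x hx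
    obtain ⟨a, ha, rfl⟩ := Finset.mem_image.1 hx
    rw [hinv a ha]
    exact Finset.mem_image_of_mem _ ha
  · intro x hx
    obtain ⟨a, ha, rfl⟩ := Finset.mem_image.1 hx
    rw [hinv a ha]
    exact h a ha

theorem schreier_subset_add_one {ξ : Ordinal.{0}} {E : Finset ℕ+} (hE : E ∈ schreier c ξ) :
    E ∈ schreier c (ξ + 1) := by
  refine mem_schreier_add_one_of_coloring (fun _ => 0) 1 (fun _ _ _ _ _ => le_rfl)
    (fun _ _ => one_pos) (fun a _ => a.pos) fun i => ?_
  exact mem_schreier_of_subset hE (Finset.filter_subset _ _)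

theorem mem_schreier_seq_of_lt {ξ : Ordinal.{0}} (hξ : ξ < ω₁) (hl : Order.IsSuccLimit ξ)
    {n m : ℕ+} (hnm : n < m) {E : Finset ℕ+} (hE : E ∈ schreier c (c.seq ξ n + 1)) :
    E ∈ schreier c (c.seq ξ m) := by
  induction m using PNat.recOn with
  | one => exact absurd hnm (not_lt_one)
  | succ m ih =>
    refine c.nested ξ hξ hl m E ?_
    rcases (PNat.lt_add_one_iff.1 hnm).lt_or_eq with h | rfl
    · exact schreier_subset_add_one (ih h)
    · exact hE

theorem exists_le_seq {ξ ζ : Ordinal.{0}} (hξ : ξ < ω₁) (hl : Order.IsSuccLimit ξ) (hζ : ζ < ξ) :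
    ∃ n, ζ < c.seq ξ n := by
  obtain ⟨_, ⟨n, rfl⟩, h⟩ := (lt_isLUB_iff (c.isLUB ξ hξ hl)).1 hζ
  exact ⟨n, h⟩

/-- For `ζ ≤ η` the tails of the family of order `ζ` are contained in the family of order `η`. -/
theorem exists_tail_subset {ζ η : Ordinal.{0}} (hη : η < ω₁) (h : ζ ≤ η) :
    ∃ n : ℕ+, ∀ E ∈ schreier c ζ, (∀ a ∈ E, n ≤ a) → E ∈ schreier c η := by
  induction η using Ordinal.limitRecOn with
  | zero =>
    obtain rfl : ζ = 0 := le_antisymm h zero_le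
    exact ⟨1, fun E hE _ => hE⟩
  | add_one η ih =>
    rcases h.lt_or_eq with h | rfl
    · obtain ⟨n, hn⟩ := ih ((lt_add_one η).trans hη) (Order.lt_add_one_iff.1 h)
      exact ⟨n, fun E hE ha => schreier_subset_add_one (hn E hE ha)⟩
    · exact ⟨1, fun E hE _ => hE⟩
  | limit η hl ih =>
    rcases h.lt_or_eq with h | rfl
    · obtain ⟨m, hm⟩ := exists_le_seq (c := c) hη hl h
      obtain ⟨n, hn⟩ := ih _ (c.seq_lt η hl m) ((c.seq_lt η hl m).trans hη) hm.le
      refine ⟨max n m, fun E hE ha => ?_⟩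
      rw [mem_schreier_limit_iff c η hl]
      rcases E.eq_empty_or_nonempty with h0 | h0
      · exact Or.inl h0
      · exact Or.inr ⟨h0, m, fun a h1 => (le_max_right _ _).trans (ha a h1),
          schreier_subset_add_one (hn E hE fun a h1 => (le_max_left _ _).trans (ha a h1))⟩
    · exact ⟨1, fun E hE _ => hE⟩

/-! ### Schreier families of order `ι + ρ`. -/

/-- A diagonal bound for the limit cases: there the index of the approximating family is at most
every point of the set, so one function can replace a separate one for each index. -/
theorem exists_ge_of_le_index (h : ℕ+ → ℕ+ → ℕ+) : ∃ T : ℕ+ → ℕ+, ∀ n j, j ≤ n → h j n ≤ T n :=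
  ⟨fun n => (Finset.Icc 1 n).sup fun j => h j n, fun n _ hj =>
    Finset.le_sup (f := fun j => h j n) (Finset.mem_Icc.2 ⟨one_le, hj⟩)⟩

theorem exists_strictMono_ge (h : ℕ+ → ℕ+) : ∃ Φ : ℕ+ → ℕ+, StrictMono Φ ∧ ∀ n, h n ≤ Φ n := by
  refine ⟨fun n => ⟨n + ∑ i ∈ Finset.Icc 1 n, (h i : ℕ), Nat.add_pos_left n.pos _⟩, ?_, ?_⟩
  · intro a b hab
    refine (PNat.coe_lt_coe _ _).1 (add_lt_add_of_lt_of_le ((PNat.coe_lt_coe _ _).2 hab) ?_)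
    exact Finset.sum_le_sum_of_subset (Finset.Icc_subset_Icc_right hab.le)
  · intro n
    refine (PNat.coe_le_coe _ _).1 (le_add_left ?_)
    exact Finset.single_le_sum (f := fun i => (h i : ℕ)) (fun _ _ => Nat.zero_le _)
      (Finset.mem_Icc.2 ⟨one_le, le_rfl⟩)

/-- Sufficiently spread unions of members of `S_ι` along a member of `S_ρ` belong to
`S_{ι + ρ}`. -/
theorem exists_union_mem_schreier_add (ι ρ : Ordinal.{0}) (h : ι + ρ < ω₁) :
    ∃ T : ℕ+ → ℕ+, (∀ n, n ≤ T n) ∧ ∀ (E : Finset ℕ+) (π : ℕ+ → ℕ+), MonotoneOn π E →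
      (∀ v, {a ∈ E | π a = v} ∈ schreier c ι) → E.image π ∈ schreier c ρ →
      (∀ a ∈ E, T (π a) ≤ a) → E ∈ schreier c (ι + ρ) := by
  induction ρ using Ordinal.limitRecOn with
  | zero =>
    refine ⟨id, fun _ => le_rfl, fun E π _ h1 h2 _ => ?_⟩
    rw [add_zero]
    rw [mem_schreier_zero_iff] at h2
    obtain h2 | ⟨n, h2⟩ := h2
    · rw [Finset.image_eq_empty.1 h2]
      exact empty_mem_schreier c ι
    · refine mem_schreier_of_subset (h1 n) fun a ha => Finset.mem_filter.2 ⟨ha, ?_⟩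
      have := Finset.mem_image_of_mem π ha
      rwa [h2, Finset.mem_singleton] at this
  | add_one ρ ih =>
    rw [← add_assoc] at h ⊢
    obtain ⟨T, h0, hT⟩ := ih ((lt_add_one _).trans h)
    refine ⟨T, h0, fun E π h1 h2 h3 h4 => ?_⟩
    obtain ⟨φ, k, h5, h6, h7, h8⟩ := exists_coloring_of_mem_schreier_add_one h3
    refine mem_schreier_add_one_of_coloring (φ ∘ π) k
      (fun a ha b hb hab => h5 (Finset.mem_image_of_mem π ha) (Finset.mem_image_of_mem π hb)
        (h1 ha hb hab))
      (fun a ha => h6 _ (Finset.mem_image_of_mem π ha))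
      -- This is where `n ≤ T n` is needed: `k ≤ π a ≤ T (π a) ≤ a`.
      (fun a ha => (h7 _ (Finset.mem_image_of_mem π ha)).trans ((h0 _).trans (h4 a ha)))
      fun i => ?_
    refine hT _ π (h1.mono fun a ha => (Finset.mem_filter.1 ha).1) (fun v => ?_) ?_
      fun a ha => h4 a (Finset.mem_filter.1 ha).1
    · exact mem_schreier_of_subset (h2 v) (Finset.filter_subset_filter _ (Finset.filter_subset _ _))
    · refine mem_schreier_of_subset (h8 i) fun b hb => ?_
      obtain ⟨a, ha, rfl⟩ := Finset.mem_image.1 hb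
      rw [Finset.mem_filter] at ha ⊢
      exact ⟨Finset.mem_image_of_mem π ha.1, ha.2⟩
  | limit ρ hl ih =>
    have hlt : ∀ n, ι + (c.seq ρ n + 1) < ι + ρ := fun n =>
      add_lt_add_right (hl.add_one_lt (c.seq_lt ρ hl n)) ι
    have h1 := fun n => ih _ (hl.add_one_lt (c.seq_lt ρ hl n)) ((hlt n).trans h)
    have h2 := fun n => exists_tail_subset (c := c) h (hlt n).le
    choose T hT0 hT using h1
    choose t ht using h2
    -- `T j` handles the order `c.seq ρ j + 1`, and beyond `t j` the family of order `ι + (c.seq ρ j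
    -- + 1)` is contained in that of order `ι + ρ`; these orders need not occur in the sequence
    -- fixed for `ι + ρ`.
    obtain ⟨T', hT'⟩ := exists_ge_of_le_index fun j n => max n (max (T j n) (t j))
    refine ⟨T', fun n => (le_max_left _ _).trans (hT' n 1 one_le), fun E π h3 h4 h5 h6 => ?_⟩
    rw [mem_schreier_limit_iff c ρ hl] at h5
    obtain h5 | ⟨-, n, h7, h8⟩ := h5
    · rw [Finset.image_eq_empty.1 h5]
      exact empty_mem_schreier c _
    · have h9 : ∀ a ∈ E, max (π a) (max (T n (π a)) (t n)) ≤ a := fun a ha =>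
        (hT' _ n (h7 _ (Finset.mem_image_of_mem π ha))).trans (h6 a ha)
      refine ht n E (hT n E π h3 h4 h8 fun a ha => ?_) fun a ha => ?_
      · exact (le_max_left _ _).trans ((le_max_right _ _).trans (h9 a ha))
      · exact (le_max_right _ _).trans ((le_max_right _ _).trans (h9 a ha))

/-- Every member `G` of `S_{ι + ρ}` is a union of members of `S_ι`, whose minima form, up to
spreading, a member of `S_ρ`; here `μ` maps a point to the minimum of its part. -/
theorem exists_decomposition_of_mem_schreier_add (ι ρ : Ordinal.{0}) (h : ι + ρ < ω₁) :
    ∃ Φ : ℕ+ → ℕ+, StrictMono Φ ∧ ∀ G ∈ schreier c (ι + ρ), ∃ μ : ℕ+ → ℕ+,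
      (∀ a ∈ G, μ a ∈ G ∧ μ a ≤ a ∧ μ (μ a) = μ a) ∧ MonotoneOn μ G ∧
      (∀ v, {a ∈ G | μ a = v} ∈ schreier c ι) ∧ (G.image μ).image Φ ∈ schreier c ρ := by
  induction ρ using Ordinal.limitRecOn with
  | zero =>
    refine ⟨id, strictMono_id, fun G hG => ?_⟩
    rw [add_zero] at hG
    rcases G.eq_empty_or_nonempty with rfl | h0
    · exact ⟨id, by simp, by simp [MonotoneOn], fun v => by simpa using empty_mem_schreier c ι,
        by simpa using empty_mem_schreier c 0⟩
    · refine ⟨fun _ => G.min' h0, fun a ha => ⟨G.min'_mem h0, G.min'_le a ha, rfl⟩,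
        fun _ _ _ _ _ => le_rfl, fun v => mem_schreier_of_subset hG (Finset.filter_subset _ _), ?_⟩
      rw [Finset.image_const h0, Finset.image_singleton]
      exact singleton_mem_schreier c _ 0
  | add_one ρ ih =>
    rw [← add_assoc] at h ⊢
    obtain ⟨Φ, hΦ, hd⟩ := ih ((lt_add_one _).trans h)
    refine ⟨Φ, hΦ, fun G hG => ?_⟩
    obtain ⟨φ, k, h1, h2, h3, h4⟩ := exists_coloring_of_mem_schreier_add_one hG
    choose μ hμ1 hμ2 hμ3 hμ4 using fun i => hd _ (h4 i)
    have key : ∀ a ∈ G, (μ (φ a) a ∈ G ∧ φ (μ (φ a) a) = φ a) ∧ μ (φ a) a ≤ a ∧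
        μ (φ a) (μ (φ a) a) = μ (φ a) a := fun a ha => by
      have := hμ1 (φ a) a (Finset.mem_filter.2 ⟨ha, rfl⟩)
      rwa [Finset.mem_filter] at this
    -- The decompositions of the colour classes are glued. Each `μ (φ a)` preserves the colour of
    -- `a`, so points of different colours stay in order.
    refine ⟨fun a => μ (φ a) a, fun a ha => ?_, fun a ha b hb hab => ?_, fun v => ?_, ?_⟩
    · obtain ⟨⟨h5, h6⟩, h7, h8⟩ := key a ha
      refine ⟨h5, h7, ?_⟩
      change μ (φ (μ (φ a) a)) (μ (φ a) a) = μ (φ a) a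
      rw [h6, h8]
    · change μ (φ a) a ≤ μ (φ b) b
      rcases (h1 ha hb hab).lt_or_eq with h5 | h5
      · obtain ⟨⟨h6, h7⟩, -, -⟩ := key b hb
        obtain ⟨-, h8, -⟩ := key a ha
        refine h8.trans ?_
        by_contra! h9
        have := h1 h6 ha h9.le
        omega
      · rw [h5]
        exact hμ2 (φ b) (Finset.mem_filter.2 ⟨ha, h5⟩) (Finset.mem_filter.2 ⟨hb, rfl⟩) hab
    · refine mem_schreier_of_subset (hμ3 (φ v) v) fun a ha => ?_
      obtain ⟨ha', rfl⟩ := Finset.mem_filter.1 ha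
      obtain ⟨⟨h5, h6⟩, -, -⟩ := key a ha'
      simp only [Finset.mem_filter, h6]
      exact ⟨⟨ha', trivial⟩, trivial⟩
    -- The image under `Φ` is coloured through the inverse of `Φ`; the bound on the number of
    -- colours survives because `x ≤ Φ x`.
    · have hinv := Function.leftInverse_invFun hΦ.injective
      have hmem : ∀ x ∈ (G.image fun a => μ (φ a) a).image Φ, ∃ a ∈ G, x = Φ (μ (φ a) a) ∧
          φ (Function.invFun Φ x) = φ a ∧ Function.invFun Φ x ∈ G ∧
          Φ (Function.invFun Φ x) = x := by
        intro x hx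
        rw [Finset.image_image] at hx
        obtain ⟨a, ha, rfl⟩ := Finset.mem_image.1 hx
        obtain ⟨⟨h5, h6⟩, -, -⟩ := key a ha
        refine ⟨a, ha, rfl, ?_, ?_, ?_⟩
        · rw [Function.comp_apply, hinv, h6]
        · rwa [Function.comp_apply, hinv]
        · rw [Function.comp_apply, hinv]
      refine mem_schreier_add_one_of_coloring (fun x => φ (Function.invFun Φ x)) k ?_ ?_ ?_ ?_
      · intro x hx y hy hxy
        obtain ⟨-, -, -, -, h5, h6⟩ := hmem x hx
        obtain ⟨-, -, -, -, h7, h8⟩ := hmem y hy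
        refine h1 h5 h7 (hΦ.le_iff_le.1 ?_)
        rwa [h6, h8]
      · intro x hx
        obtain ⟨-, -, -, -, h5, h6⟩ := hmem x hx
        exact h2 _ h5
      · intro x hx
        obtain ⟨-, -, -, -, h5, h6⟩ := hmem x hx
        refine (h3 _ h5).trans ?_
        rw [PNat.coe_le_coe]
        exact (hΦ.le_apply).trans_eq h6
      · intro i
        refine mem_schreier_of_subset (hμ4 i) fun x hx => ?_
        obtain ⟨hx', rfl⟩ := Finset.mem_filter.1 hx
        obtain ⟨a, h5, h6, h7, -, -⟩ := hmem x hx'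
        rw [Finset.image_image, Finset.mem_image, h7]
        exact ⟨a, Finset.mem_filter.2 ⟨h5, rfl⟩, h6.symm⟩
  | limit ρ hl ih =>
    have hρ : 0 < ρ := hl.bot_lt
    have hl' : Order.IsSuccLimit (ι + ρ) := Ordinal.isSuccLimit_add ι hl
    -- The sequence fixed for `ι + ρ` is unrelated to the one fixed for `ρ`. From `n₀` on its terms
    -- exceed `ι`; subtracting `ι` from their successors leaves orders below `ρ`, to which the
    -- induction hypothesis applies.
    obtain ⟨n₀, hn₀⟩ := exists_le_seq (c := c) h hl' (lt_add_of_pos_right ι hρ)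
    have hle : ∀ n : ℕ+, ι ≤ c.seq (ι + ρ) (max n n₀) + 1 := fun n =>
      hn₀.le.trans (((c.strictMono _ h hl').monotone (le_max_right n n₀)).trans (lt_add_one _).le)
    have heq : ∀ n : ℕ+, ι + (c.seq (ι + ρ) (max n n₀) + 1 - ι) = c.seq (ι + ρ) (max n n₀) + 1 :=
      fun n => Ordinal.add_sub_cancel_of_le (hle n)
    have hlt' : ∀ n : ℕ+, c.seq (ι + ρ) (max n n₀) + 1 < ι + ρ := fun n =>
      hl'.add_one_lt (c.seq_lt _ hl' _)
    have hlt : ∀ n : ℕ+, c.seq (ι + ρ) (max n n₀) + 1 - ι < ρ := fun n => by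
      rw [← add_lt_add_iff_left ι, heq]
      exact hlt' n
    have hρ' : ρ < ω₁ := (le_add_left le_rfl).trans_lt h
    choose Ψ hΨ hd using fun n => ih _ (hlt n) (by rw [heq]; exact (hlt' n).trans h)
    choose t ht using fun n => exists_tail_subset (c := c) hρ' (hlt n).le
    obtain ⟨T, hT⟩ := exists_ge_of_le_index fun j n => max (Ψ j n) (t j)
    obtain ⟨Φ, hΦ, hTΦ⟩ := exists_strictMono_ge T
    refine ⟨Φ, hΦ, fun G hG => ?_⟩
    have hG' : G = ∅ ∨ ∃ n : ℕ+, (∀ a ∈ G, n ≤ a) ∧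
        G ∈ schreier c (c.seq (ι + ρ) (max n n₀) + 1) := by
      rw [mem_schreier_limit_iff c _ hl'] at hG
      refine hG.imp id fun ⟨_, n, h1, h2⟩ => ⟨n, h1, ?_⟩
      rcases (le_max_left n n₀).lt_or_eq with h3 | h3
      · exact schreier_subset_add_one (mem_schreier_seq_of_lt h hl' h3 h2)
      · rwa [← h3]
    obtain rfl | ⟨n, h1, h2⟩ := hG'
    · exact ⟨id, by simp, by simp [MonotoneOn], fun v => by simpa using empty_mem_schreier c ι,
        by simpa using empty_mem_schreier c ρ⟩
    obtain ⟨μ, h3, h4, h5, h6⟩ := hd n G (by rwa [heq])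
    -- Values of `μ` lie in `G`, hence are at least `n`, as the diagonal bound demands.
    have h7 : ∀ a ∈ G.image μ, max (Ψ n a) (t n) ≤ Φ a := by
      intro a ha
      obtain ⟨b, hb, rfl⟩ := Finset.mem_image.1 ha
      exact (hT _ n (h1 _ (h3 b hb).1)).trans (hTΦ _)
    refine ⟨μ, h3, h4, h5, ht n _ (image_mem_schreier h6 ((hΨ n).strictMonoOn _)
      (hΦ.strictMonoOn _) fun a ha => (le_max_left _ _).trans (h7 a ha)) fun x hx => ?_⟩
    obtain ⟨a, ha, rfl⟩ := Finset.mem_image.1 hx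
    exact (le_max_right _ _).trans (h7 a ha)

/-! ### Averaging rules and the successive blocks they cut out of a set. -/

theorem least_mem {M : Set ℕ+} (hM : M.Nonempty) : least M ∈ M := by
  rw [least, dif_pos hM]
  exact WellFounded.min_mem _ _ _

theorem least_le {M : Set ℕ+} {a : ℕ+} (ha : a ∈ M) : least M ≤ a := by
  rw [least, dif_pos ⟨a, ha⟩]
  exact not_lt.1 (WellFounded.not_lt_min _ _ ha)

/-- The rule `A` attaches to each infinite set `M` a probability whose support is a nonempty
initial segment of `M`. -/
structure IsAveraging (A : Set ℕ+ → ℕ+ →₀ ℝ) : Prop where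
  nonneg : ∀ M : Set ℕ+, M.Infinite → ∀ a, 0 ≤ A M a
  sum_eq_one : ∀ M : Set ℕ+, M.Infinite → ((A M).sum fun _ t => t) = 1
  least_mem : ∀ M : Set ℕ+, M.Infinite → least M ∈ (A M).support
  subset : ∀ M : Set ℕ+, M.Infinite → ((A M).support : Set ℕ+) ⊆ M
  initial : ∀ M : Set ℕ+, M.Infinite → ∀ a ∈ M, ∀ b ∈ (A M).support, a ≤ b → a ∈ (A M).support

section

variable {A : Set ℕ+ → ℕ+ →₀ ℝ} {M : Set ℕ+}

theorem remainder_infinite (hM : M.Infinite) (n : ℕ) : (remainder A M n).Infinite := by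
  induction n with
  | zero => exact hM
  | succ n ih => exact ih.sdiff (Finset.finite_toSet _)

theorem remainder_antitone : Antitone (remainder A M) :=
  antitone_nat_of_succ_le fun _ => Set.sdiff_subset

theorem remainder_subset (n : ℕ) : remainder A M n ⊆ M := remainder_antitone (Nat.zero_le n)

theorem exists_mem_support_of_notMem_remainder {n : ℕ} {a : ℕ+} (ha : a ∈ M)
    (h : a ∉ remainder A M n) :
    ∃ k < n, a ∈ (A (remainder A M k)).support := by
  induction n with
  | zero => exact absurd ha h
  | succ n ih =>
    by_cases h1 : a ∈ remainder A M n
    · exact ⟨n, n.lt_succ_self, by_contra fun h2 => h ⟨h1, h2⟩⟩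
    · obtain ⟨k, h2, h3⟩ := ih h1
      exact ⟨k, h2.trans n.lt_succ_self, h3⟩

namespace IsAveraging

/-- The support removed at step `n` is an initial segment of what was left, so everything that
survives lies beyond it. -/
theorem lt_of_mem (hA : IsAveraging A) (hM : M.Infinite)
    {n m : ℕ} (hnm : n < m) {a b : ℕ+} (ha : a ∈ (A (remainder A M n)).support)
    (hb : b ∈ remainder A M m) : a < b := by
  have h1 : b ∈ remainder A M n \ (A (remainder A M n)).support := remainder_antitone hnm hb
  by_contra! h
  exact h1.2 (hA.initial _ (remainder_infinite hM n) b h1.1 a ha h)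

theorem mem_remainder_of_le (hA : IsAveraging A) (hM : M.Infinite)
    {n : ℕ} {a b : ℕ+} (ha : a ∈ M) (hb : b ∈ remainder A M n)
    (hba : b ≤ a) : a ∈ remainder A M n := by
  induction n with
  | zero => exact ha
  | succ n ih =>
    exact ⟨ih hb.1, fun h => hb.2 (hA.initial _ (remainder_infinite hM n) b hb.1 a h hba)⟩

theorem support_subset_remainder (hA : IsAveraging A) (hM : M.Infinite) (n : ℕ) :
    ((A (remainder A M n)).support : Set ℕ+) ⊆ remainder A M n :=
  hA.subset _ (remainder_infinite hM n)

theorem support_subset (hA : IsAveraging A) (hM : M.Infinite)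
    (n : ℕ) : ((A (remainder A M n)).support : Set ℕ+) ⊆ M :=
  (hA.support_subset_remainder hM n).trans (remainder_subset n)

theorem support_lt (hA : IsAveraging A) (hM : M.Infinite)
    {n m : ℕ} (hnm : n < m) {a b : ℕ+} (ha : a ∈ (A (remainder A M n)).support)
    (hb : b ∈ (A (remainder A M m)).support) : a < b :=
  hA.lt_of_mem hM hnm ha (hA.support_subset_remainder hM m hb)

theorem eq_of_mem (hA : IsAveraging A) (hM : M.Infinite)
    {n m : ℕ} {a : ℕ+} (ha : a ∈ (A (remainder A M n)).support)
    (hb : a ∈ (A (remainder A M m)).support) : n = m := by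
  rcases lt_trichotomy n m with h | h | h
  · exact absurd (hA.support_lt hM h ha hb) (lt_irrefl a)
  · exact h
  · exact absurd (hA.support_lt hM h hb ha) (lt_irrefl a)

theorem least_remainder_mem (hA : IsAveraging A) (hM : M.Infinite) (n : ℕ) :
    least (remainder A M n) ∈ (A (remainder A M n)).support :=
  hA.least_mem _ (remainder_infinite hM n)

theorem lt_least_remainder (hA : IsAveraging A) (hM : M.Infinite)
    (n : ℕ) : n < (least (remainder A M n) : ℕ) := by
  induction n with
  | zero => exact PNat.pos _
  | succ n ih =>
    have h := (PNat.coe_lt_coe _ _).2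
      (hA.support_lt hM n.lt_succ_self (hA.least_remainder_mem hM n)
        (hA.least_remainder_mem hM (n + 1)))
    omega

theorem sum_le_one (hA : IsAveraging A) (hM : M.Infinite) (G : Finset ℕ+) : ∑ a ∈ G, A M a ≤ 1 := by
  classical
  rw [← hA.sum_eq_one M hM, Finsupp.sum, ← Finset.sum_filter_of_ne (p := (· ∈ (A M).support))
    fun a _ h => Finsupp.mem_support_iff.2 h]
  exact Finset.sum_le_sum_of_subset_of_nonneg (fun a ha => (Finset.mem_filter.1 ha).2)
    fun a _ _ => hA.nonneg M hM a

end IsAveraging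

end

/-! ### Repeated averages as averaging rules. -/

theorem firstAverage_zero (c : System) (M : Set ℕ+) :
    firstAverage c 0 M = Finsupp.single (least M) 1 := by
  rw [firstAverage, Ordinal.limitRecOn_zero]

theorem firstAverage_add_one (c : System) (ξ : Ordinal.{0}) (M : Set ℕ+) :
    firstAverage c (ξ + 1) M = (1 / ((least M : ℕ) : ℝ)) •
      ∑ n ∈ Finset.range (least M), firstAverage c ξ (remainder (firstAverage c ξ) M n) := by
  rw [firstAverage, Ordinal.limitRecOn_add_one]
  congr 1
  refine Finset.sum_nbij' PNat.natPred Nat.succPNat (fun j hj => ?_) (fun n hn => ?_)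
    (fun j _ => PNat.succPNat_natPred j) (fun n _ => Nat.natPred_succPNat n) fun j _ => rfl
  · rw [Finset.mem_range, PNat.natPred]
    have := (PNat.coe_le_coe _ _).2 (Finset.mem_Icc.1 hj).2
    have := j.pos
    omega
  · rw [Finset.mem_Icc, ← PNat.coe_le_coe, ← PNat.coe_le_coe, Nat.succPNat_coe]
    exact ⟨Nat.succ_pos n, Finset.mem_range.1 hn⟩

theorem firstAverage_limit (c : System) {ξ : Ordinal.{0}} (hξ : Order.IsSuccLimit ξ)
    (M : Set ℕ+) : firstAverage c ξ M = firstAverage c (c.seq ξ (least M) + 1) M := by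
  rw [firstAverage, Ordinal.limitRecOn_limit _ _ _ _ hξ]
  rfl

theorem firstAverage_add_one_apply (c : System) (ξ : Ordinal.{0}) (M : Set ℕ+) (a : ℕ+) :
    firstAverage c (ξ + 1) M a = (1 / ((least M : ℕ) : ℝ)) *
      ∑ n ∈ Finset.range (least M), firstAverage c ξ (remainder (firstAverage c ξ) M n) a := by
  rw [firstAverage_add_one, Finsupp.smul_apply, smul_eq_mul, Finsupp.finsetSum_apply]

theorem IsAveraging.support_firstAverage_add_one {ξ : Ordinal.{0}}
    (hA : IsAveraging (firstAverage c ξ)) {M : Set ℕ+} (hM : M.Infinite) (a : ℕ+) :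
    a ∈ (firstAverage c (ξ + 1) M).support ↔ ∃ n < (least M : ℕ),
      a ∈ (firstAverage c ξ (remainder (firstAverage c ξ) M n)).support := by
  have h0 : (1 / ((least M : ℕ) : ℝ)) ≠ 0 := by
    have := (least M).ne_zero
    positivity
  rw [Finsupp.mem_support_iff, firstAverage_add_one_apply, mul_ne_zero_iff,
    and_iff_right h0, Ne, Finset.sum_eq_zero_iff_of_nonneg
    fun n _ => hA.nonneg _ (remainder_infinite hM n) a]
  simp

theorem isAveraging_firstAverage (c : System) (ξ : Ordinal.{0}) :
    IsAveraging (firstAverage c ξ) := by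
  induction ξ using Ordinal.limitRecOn with
  | zero =>
    have h : ∀ M, (firstAverage c 0 M).support = {least M} := fun M => by
      rw [firstAverage_zero, Finsupp.support_single _ one_ne_zero]
    refine ⟨fun M _ a => ?_, fun M _ => ?_, fun M _ => ?_, fun M hM => ?_,
      fun M hM a ha b hb hab => ?_⟩
    · rw [firstAverage_zero, Finsupp.single_apply]
      split_ifs <;> norm_num
    · rw [firstAverage_zero, Finsupp.sum_single_index rfl]
    · rw [h]
      exact Finset.mem_singleton_self _
    · rw [h, Finset.coe_singleton, Set.singleton_subset_iff]
      exact SchreierSpaces.least_mem hM.nonempty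
    · rw [h, Finset.mem_singleton] at hb ⊢
      exact le_antisymm (hab.trans_eq hb) (least_le ha)
  | add_one ξ ih =>
    refine ⟨fun M hM a => ?_, fun M hM => ?_, fun M hM => ?_, fun M hM => ?_,
      fun M hM a ha b hb hab => ?_⟩
    · rw [firstAverage_add_one_apply]
      exact mul_nonneg (by positivity)
        (Finset.sum_nonneg fun n _ => ih.nonneg _ (remainder_infinite hM n) a)
    · rw [firstAverage_add_one, Finsupp.sum_smul_index fun _ => rfl, ← Finsupp.mul_sum,
        ← Finsupp.sum_finsetSum_index (fun _ => rfl) (fun _ _ _ => rfl),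
        Finset.sum_congr rfl fun n _ => ih.sum_eq_one _ (remainder_infinite hM n),
        Finset.sum_const, Finset.card_range, nsmul_one]
      exact one_div_mul_cancel (Nat.cast_ne_zero.2 (least M).ne_zero)
    · exact (ih.support_firstAverage_add_one hM _).2 ⟨0, (least M).pos, ih.least_mem M hM⟩
    · intro a ha
      obtain ⟨n, -, h⟩ := (ih.support_firstAverage_add_one hM a).1 ha
      exact ih.support_subset hM n h
    · obtain ⟨n, hn, h⟩ := (ih.support_firstAverage_add_one hM b).1 hb
      refine (ih.support_firstAverage_add_one hM a).2 ?_
      -- A point of `M` not beyond a point of block `n` has been used up by one of the blocks `0, …,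
      -- n`.
      obtain ⟨k, hk, h1⟩ := exists_mem_support_of_notMem_remainder ha (n := n + 1) fun h2 =>
        hab.not_gt (ih.lt_of_mem hM n.lt_succ_self h h2)
      exact ⟨k, by omega, h1⟩
  | limit ξ hξ ih =>
    have h := fun M => ih _ (hξ.add_one_lt (c.seq_lt ξ hξ (least M)))
    refine ⟨fun M hM => ?_, fun M hM => ?_, fun M hM => ?_, fun M hM => ?_, fun M hM => ?_⟩ <;>
      rw [firstAverage_limit c hξ]
    · exact (h M).nonneg M hM
    · exact (h M).sum_eq_one M hM
    · exact (h M).least_mem M hM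
    · exact (h M).subset M hM
    · exact (h M).initial M hM

/-- In the successor step the colours are the indices of the lower-order blocks; their number `least
M` is also a lower bound for the support. -/
theorem support_firstAverage_mem_schreier (c : System) (ξ : Ordinal.{0}) {M : Set ℕ+}
    (hM : M.Infinite) : (firstAverage c ξ M).support ∈ schreier c ξ := by
  induction ξ using Ordinal.limitRecOn generalizing M with
  | zero =>
    rw [firstAverage_zero, Finsupp.support_single _ one_ne_zero]
    exact singleton_mem_schreier c _ 0
  | add_one ξ ih =>
    have hA := isAveraging_firstAverage c ξ
    have hφ : ∀ a ∈ (firstAverage c (ξ + 1) M).support, ∃ n < (least M : ℕ),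
        a ∈ (firstAverage c ξ (remainder (firstAverage c ξ) M n)).support := fun a ha =>
      (hA.support_firstAverage_add_one hM a).1 ha
    choose! φ h1 h2 using hφ
    refine mem_schreier_add_one_of_coloring φ (least M) (fun a ha b hb hab => ?_) h1
      (fun a ha => (PNat.coe_le_coe _ _).2
        (least_le ((isAveraging_firstAverage c (ξ + 1)).subset M hM ha))) fun i => ?_
    · by_contra! h
      exact hab.not_gt (hA.support_lt hM h (h2 b hb) (h2 a ha))
    · refine mem_schreier_of_subset (ih (remainder_infinite (A := firstAverage c ξ) hM i))
        fun a ha => ?_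
      obtain ⟨h, rfl⟩ := Finset.mem_filter.1 ha
      exact h2 a h
  | limit ξ hξ ih =>
    rw [firstAverage_limit c hξ, mem_schreier_limit_iff c ξ hξ]
    have hA := isAveraging_firstAverage c (c.seq ξ (least M) + 1)
    exact Or.inr ⟨⟨_, hA.least_mem M hM⟩, least M, fun a ha => least_le (hA.subset M hM ha),
      ih _ (hξ.add_one_lt (c.seq_lt ξ hξ _)) hM⟩

/-! ### Small mass of the averages on Schreier sets that start early. -/

/-- `M` is so sparse that `2 ^ (a + 2) * a ≤ b` for `a < b` in `M`. -/
def IsSparse (M : Set ℕ+) : Prop :=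
  ∀ a ∈ M, ∀ b ∈ M, a < b → 2 ^ ((a : ℕ) + 2) * (a : ℕ) ≤ (b : ℕ)

theorem IsSparse.mono {M N : Set ℕ+} (hM : IsSparse M) (h : N ⊆ M) : IsSparse N :=
  fun a ha b hb => hM a (h ha) b (h hb)

/-- No point of `M` precedes block `0`. For a later block `n`, let `q` be the larger of `p` and the
first point of the preceding block: then `q ≥ p` and `q ≥ n`, and sparseness at `q` gives both
factors. -/
theorem IsAveraging.mul_pow_le_least {A : Set ℕ+ → ℕ+ →₀ ℝ} (hA : IsAveraging A) {M : Set ℕ+}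
    (hM : M.Infinite) (hs : IsSparse M) {p : ℕ+} (hp : p ∈ M) {n : ℕ}
    (hpn : p < least (remainder A M n)) :
    2 * (p : ℕ) * 2 ^ (n + 1) ≤ (least (remainder A M n) : ℕ) := by
  obtain ⟨n, rfl⟩ : ∃ m, n = m + 1 := by
    refine Nat.exists_eq_succ_of_ne_zero ?_
    rintro rfl
    exact absurd (least_le hp) hpn.not_ge
  have hmem := fun k => hA.support_subset hM k (hA.least_remainder_mem hM k)
  have hlt := hA.support_lt hM n.lt_succ_self (hA.least_remainder_mem hM n)
    (hA.least_remainder_mem hM (n + 1))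
  have hn := hA.lt_least_remainder hM n
  obtain ⟨q, hqM, hpq, hnq, hq⟩ : ∃ q ∈ M, p ≤ q ∧ n + 1 ≤ (q : ℕ) ∧
      q < least (remainder A M (n + 1)) := by
    rcases le_total p (least (remainder A M n)) with h | h
    · exact ⟨_, hmem n, h, hn, hlt⟩
    · exact ⟨p, hp, le_rfl, hn.trans_le h, hpn⟩
  refine le_trans ?_ (hs q hqM _ (hmem (n + 1)) hq)
  have h1 : (2 : ℕ) ^ (n + 1 + 1) ≤ 2 ^ ((q : ℕ) + 1) := Nat.pow_le_pow_right two_pos (by omega)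
  have h2 : (p : ℕ) ≤ q := hpq
  calc 2 * (p : ℕ) * 2 ^ (n + 1 + 1) ≤ 2 * q * 2 ^ ((q : ℕ) + 1) := by gcongr
    _ = 2 ^ ((q : ℕ) + 2) * q := by ring

theorem IsAveraging.div_least_le_half_pow {A : Set ℕ+ → ℕ+ →₀ ℝ} (hA : IsAveraging A)
    {M : Set ℕ+} (hM : M.Infinite) (hs : IsSparse M) {p : ℕ+} (hp : p ∈ M) {n : ℕ}
    (hpn : p < least (remainder A M n)) :
    2 * (p : ℝ) / (least (remainder A M n) : ℝ) ≤ (1 / 2) ^ (n + 1) := by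
  have h1 : (2 * (p : ℝ)) * 2 ^ (n + 1) ≤ (least (remainder A M n) : ℝ) := by
    exact_mod_cast hA.mul_pow_le_least hM hs hp hpn
  have h2 : (0 : ℝ) < (least (remainder A M n) : ℝ) := by
    exact_mod_cast (least (remainder A M n)).pos
  rw [one_div, inv_pow, div_le_iff₀ h2, inv_mul_eq_div, le_div_iff₀ (by positivity)]
  exact h1

theorem sum_indicator_le_one {N : ℕ} (P : ℕ → Prop) [DecidablePred P]
    (hP : ∀ n m, P n → P m → n = m) : ∑ n ∈ Finset.range N, (if P n then (1 : ℝ) else 0) ≤ 1 := by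
  rw [Finset.sum_boole]
  refine Nat.cast_le_one.2 (Finset.card_le_one.2 fun a ha b hb => ?_)
  exact hP a b (Finset.mem_filter.1 ha).2 (Finset.mem_filter.1 hb).2

theorem sum_half_pow_succ_le_one (N : ℕ) : ∑ n ∈ Finset.range N, (1 / 2 : ℝ) ^ (n + 1) ≤ 1 := by
  have h := sum_geometric_two_le N
  simp_rw [pow_succ, ← Finset.sum_mul]
  linarith

/-- If the averages are small on members of `S_ξ` that start before the averages do, then the
successive averages have a uniformly bounded total mass on members of `S_ξ`. -/
theorem sum_remainder_le_two_of_small {ξ : Ordinal.{0}} {A : Set ℕ+ → ℕ+ →₀ ℝ}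
    (hA : IsAveraging A) {M : Set ℕ+} (hM : M.Infinite) (hs : IsSparse M)
    (hsmall : ∀ N : Set ℕ+, N.Infinite → IsSparse N → ∀ G ∈ schreier c ξ, ∀ p ∈ G, p < least N →
      ∑ a ∈ G, A N a ≤ 2 * (p : ℝ) / (least N : ℝ)) {G : Finset ℕ+} (hG : G ∈ schreier c ξ)
    (N : ℕ) : ∑ n ∈ Finset.range N, ∑ a ∈ G, A (remainder A M n) a ≤ 2 := by
  classical
  have hzero : ∀ n, (∀ a ∈ G, a ∉ (A (remainder A M n)).support) →
      ∑ a ∈ G, A (remainder A M n) a = 0 := fun n h =>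
    Finset.sum_eq_zero fun a ha => Finsupp.notMem_support_iff.1 (h a ha)
  rcases (G.filter (· ∈ M)).eq_empty_or_nonempty with h0 | h0
  · refine le_of_eq_of_le (Finset.sum_eq_zero fun n _ => hzero n fun a ha h => ?_) zero_le_two
    exact Finset.filter_eq_empty_iff.1 h0 ha (hA.support_subset hM n h)
  -- Blocks before `p` miss `G`, the block containing `p` has mass at most `1`, and blocks starting
  -- after `p` have masses bounded by a geometric series of sum at most `1`.
  set p := (G.filter (· ∈ M)).min' h0 with hp
  obtain ⟨hpG, hpM⟩ := Finset.mem_filter.1 ((G.filter (· ∈ M)).min'_mem h0)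
  rw [← hp] at hpG hpM
  have key : ∀ n, ∑ a ∈ G, A (remainder A M n) a ≤
      (if p ∈ (A (remainder A M n)).support then (1 : ℝ) else 0) + (1 / 2) ^ (n + 1) := by
    intro n
    have hpos : (0 : ℝ) ≤ (1 / 2) ^ (n + 1) := by positivity
    have hinf := remainder_infinite (A := A) hM n
    split_ifs with h1
    · have := hA.sum_le_one hinf G
      linarith
    rw [zero_add]
    by_cases h2 : p ∈ remainder A M n
    · rw [hzero n]
      · exact hpos
      · intro a ha h3
        refine h1 (hA.initial _ hinf p h2 a h3 ?_)
        exact Finset.min'_le _ _ (Finset.mem_filter.2 ⟨ha, hA.support_subset hM n h3⟩)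
    · have h3 : p < least (remainder A M n) := by
        by_contra! h
        exact h2 (hA.mem_remainder_of_le hM hpM (least_mem hinf.nonempty) h)
      refine (hsmall _ hinf (hs.mono (remainder_subset n)) G hG p hpG h3).trans ?_
      exact hA.div_least_le_half_pow hM hs hpM h3
  refine (Finset.sum_le_sum fun n _ => key n).trans ?_
  rw [Finset.sum_add_distrib]
  have h1 := sum_indicator_le_one (N := N) (fun n => p ∈ (A (remainder A M n)).support)
    fun n m hn hm => hA.eq_of_mem hM hn hm
  have h2 := sum_half_pow_succ_le_one N
  linarith

theorem sum_firstAverage_add_one (c : System) (ξ : Ordinal.{0}) (M : Set ℕ+) (G : Finset ℕ+) :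
    ∑ a ∈ G, firstAverage c (ξ + 1) M a = (∑ n ∈ Finset.range (least M), ∑ a ∈ G,
      firstAverage c ξ (remainder (firstAverage c ξ) M n) a) / ((least M : ℕ) : ℝ) := by
  rw [Finset.sum_comm, Finset.sum_div]
  refine Finset.sum_congr rfl fun a _ => ?_
  rw [firstAverage_add_one_apply, one_div_mul_eq_div]

/-- An average of order `ζ + 1` is `1 / least M` times a sum of successive averages of order `ζ`,
and by induction a member of `S_ζ` collects at most `2` from that sum. At successor orders `G`
consists of at most `p` members of `S_ζ`. At limit orders the average has order `ζ + 1` with `ζ =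
c.seq ξ (least M)`, and the index `n ≤ p < least M` witnessing `G ∈ S_ξ` puts `G` itself into `S_ζ`.
-/
theorem sum_firstAverage_le (c : System) {ξ : Ordinal.{0}} (hξ : ξ < ω₁) {M : Set ℕ+}
    (hM : M.Infinite) (hs : IsSparse M) {G : Finset ℕ+} (hG : G ∈ schreier c ξ) {p : ℕ+}
    (hp : p ∈ G) (hpM : p < least M) :
    ∑ a ∈ G, firstAverage c ξ M a ≤ 2 * (p : ℝ) / (least M : ℝ) := by
  induction ξ using WellFoundedLT.induction generalizing M G p with
  | ind ξ ih =>
  have hbdd : ∀ ζ < ξ, ∀ {G : Finset ℕ+}, G ∈ schreier c ζ → ∑ n ∈ Finset.range (least M),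
      ∑ a ∈ G, firstAverage c ζ (remainder (firstAverage c ζ) M n) a ≤ 2 := fun ζ hζ G hG =>
    sum_remainder_le_two_of_small (isAveraging_firstAverage c ζ) hM hs
      (fun N hN hN' G hG p hp hpN => ih ζ hζ (hζ.trans hξ) hN hN' hG hp hpN) hG _
  have hm : (0 : ℝ) < (least M : ℝ) := by exact_mod_cast (least M).pos
  have hp1 : (1 : ℝ) ≤ p := by exact_mod_cast p.pos
  induction ξ using Ordinal.limitRecOn with
  | zero =>
    obtain rfl | ⟨n, rfl⟩ := (mem_schreier_zero_iff c G).1 hG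
    · exact absurd hp (Finset.notMem_empty _)
    obtain rfl := Finset.mem_singleton.1 hp
    rw [Finset.sum_singleton, firstAverage_zero, Finsupp.single_apply, if_neg hpM.ne']
    positivity
  | add_one ξ _ =>
    obtain ⟨φ, k, -, h2, h3, h4⟩ := exists_coloring_of_mem_schreier_add_one hG
    rw [sum_firstAverage_add_one]
    refine div_le_div_of_nonneg_right ?_ hm.le
    have h5 : ∀ n, ∑ a ∈ G, firstAverage c ξ (remainder (firstAverage c ξ) M n) a =
        ∑ i ∈ Finset.range k, ∑ a ∈ G with φ a = i,
          firstAverage c ξ (remainder (firstAverage c ξ) M n) a := fun n =>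
      (Finset.sum_fiberwise_of_maps_to (fun a ha => Finset.mem_range.2 (h2 a ha)) _).symm
    rw [Finset.sum_congr rfl fun n _ => h5 n, Finset.sum_comm]
    refine (Finset.sum_le_sum fun i _ => hbdd ξ (lt_add_one ξ) (h4 i)).trans ?_
    rw [Finset.sum_const, Finset.card_range, nsmul_eq_mul, mul_comm]
    exact mul_le_mul_of_nonneg_left (by exact_mod_cast h3 p hp) zero_le_two
  | limit ξ hl _ =>
    obtain rfl | ⟨-, n, h1, h2⟩ := (mem_schreier_limit_iff c ξ hl G).1 hG
    · exact absurd hp (Finset.notMem_empty _)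
    rw [firstAverage_limit c hl, sum_firstAverage_add_one]
    refine div_le_div_of_nonneg_right ?_ hm.le
    refine (hbdd _ (c.seq_lt ξ hl _) (mem_schreier_seq_of_lt hξ hl ((h1 p hp).trans_lt hpM)
      h2)).trans ?_
    linarith

/-! ### Operators on Schreier spaces; Schreier pairs from a pair of operators. -/

section

variable {ξ : Ordinal.{0}} {𝕜 : Type*} [RCLike 𝕜]

theorem norm_sum_smul_e (a : ℕ+ →₀ 𝕜) :
    ‖a.sum fun j t => t • e c ξ 𝕜 j‖ = ‖C00.of c ξ 𝕜 a‖ := by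
  have h := coe_eq_sum (C00.of c ξ 𝕜 a)
  rw [LinearEquiv.symm_apply_apply] at h
  rw [← h, UniformSpace.Completion.norm_coe]

theorem norm_e (j : ℕ+) : ‖e c ξ 𝕜 j‖ = 1 := by
  classical
  rw [e, UniformSpace.Completion.norm_coe]
  refine le_antisymm (C00.norm_le fun E _ => ?_) ?_
  · have h : ∀ i, ‖C00.of c ξ 𝕜 (Finsupp.single j 1) i‖ = if j = i then 1 else 0 := fun i => by
      rw [C00.of_apply, Finsupp.single_apply]
      split_ifs <;> simp
    rw [Finset.sum_congr rfl fun i _ => h i, Finset.sum_ite_eq]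
    split_ifs <;> norm_num
  · have h := C00.norm_apply_le (C00.of c ξ 𝕜 (Finsupp.single j (1 : 𝕜))) j
    rwa [C00.of_apply, Finsupp.single_eq_same, norm_one] at h

theorem norm_f_le (j : ℕ+) : ‖f c ξ 𝕜 j‖ ≤ 1 := by
  refine ContinuousLinearMap.opNorm_le_bound _ zero_le_one fun z => ?_
  rw [one_mul]
  induction z using UniformSpace.Completion.induction_on with
  | hp => exact isClosed_le (f c ξ 𝕜 j).continuous.norm continuous_norm
  | ih z =>
    rw [f_coe, UniformSpace.Completion.norm_coe]
    exact C00.norm_apply_le z j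

theorem sum_norm_f_le {E : Finset ℕ+} (hE : E ∈ schreier c ξ) (z : Space c ξ 𝕜) :
    ∑ j ∈ E, ‖f c ξ 𝕜 j z‖ ≤ ‖z‖ := by
  induction z using UniformSpace.Completion.induction_on with
  | hp =>
    exact isClosed_le (continuous_finsetSum _ fun j _ => (f c ξ 𝕜 j).continuous.norm)
      continuous_norm
  | ih z =>
    simp_rw [f_coe, UniformSpace.Completion.norm_coe]
    exact C00.sum_le_norm z hE

/-- The norm is monotone in the moduli of the coordinates, so coordinate projections are
contractions; this underlies the bounded partial sums of a Schreier pair. -/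
theorem norm_sum_f_smul_e_le (s : Finset ℕ+) (z : Space c ξ 𝕜) :
    ‖∑ j ∈ s, f c ξ 𝕜 j z • e c ξ 𝕜 j‖ ≤ ‖z‖ := by
  classical
  induction z using UniformSpace.Completion.induction_on with
  | hp =>
    exact isClosed_le (continuous_finsetSum _ fun j _ =>
      (f c ξ 𝕜 j).continuous.smul continuous_const).norm continuous_norm
  | ih z =>
    have h : ∑ j ∈ s, f c ξ 𝕜 j (z : Space c ξ 𝕜) • e c ξ 𝕜 j =
        (((C00.of c ξ 𝕜).symm z).filter (· ∈ s)).sum fun j t => t • e c ξ 𝕜 j := by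
      rw [Finsupp.sum_filter_index, Finsupp.support_filter, ← Finset.sum_subset (s₁ :=
        ((C00.of c ξ 𝕜).symm z).support.filter (· ∈ s)) fun j hj => (Finset.mem_filter.1 hj).2]
      · exact Finset.sum_congr rfl fun j _ => by rw [f_coe, C00.of_symm_apply]
      · intro j hj h
        have : z j = 0 := by
          by_contra h0
          exact h (Finset.mem_filter.2 ⟨Finsupp.mem_support_iff.2 h0, hj⟩)
        rw [f_coe, this, zero_smul]
    rw [h, norm_sum_smul_e, UniformSpace.Completion.norm_coe]
    refine C00.norm_le fun E hE => le_trans (Finset.sum_le_sum fun j _ => ?_)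
      (C00.sum_le_norm z hE)
    rw [C00.of_apply, Finsupp.filter_apply]
    split_ifs
    · exact le_rfl
    · rw [norm_zero]
      exact norm_nonneg _

variable {W : Type*} [NormedAddCommGroup W] [NormedSpace 𝕜 W]

theorem map_finsuppSum_smul {X : Type*} [NormedAddCommGroup X] [NormedSpace 𝕜 X]
    (U : X →L[𝕜] W) (a : ℕ+ →₀ 𝕜) (y : ℕ+ → X) :
    U (a.sum fun i t => t • y i) = a.sum fun i t => t • U (y i) := by
  rw [map_finsuppSum]
  exact Finset.sum_congr rfl fun i _ => map_smul U _ _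

theorem continuousLinearMap_ext {U V : Space c ξ 𝕜 →L[𝕜] W}
    (h : ∀ j, U (e c ξ 𝕜 j) = V (e c ξ 𝕜 j)) : U = V := by
  ext z
  induction z using UniformSpace.Completion.induction_on with
  | hp => exact isClosed_eq U.continuous V.continuous
  | ih z =>
    simp only [coe_eq_sum z, map_finsuppSum_smul, h]

/-- A sequence dominated by the basis of `X_ξ` is the image of the basis under an operator. -/
theorem IsDominatedWith.exists_operator [CompleteSpace W] {C : ℝ} {v : ℕ+ → W}
    (h : IsDominatedWith 𝕜 C v (e c ξ 𝕜)) :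
    ∃ U : Space c ξ 𝕜 →L[𝕜] W, (∀ j, U (e c ξ 𝕜 j) = v j) ∧ ∀ z, ‖U z‖ ≤ C * ‖z‖ := by
  let u : C00 c ξ 𝕜 →L[𝕜] W := LinearMap.mkContinuous
    ((Finsupp.linearCombination 𝕜 v).comp (C00.of c ξ 𝕜).symm.toLinearMap) C fun z => by
      have h1 := h ((C00.of c ξ 𝕜).symm z)
      rwa [norm_sum_smul_e, LinearEquiv.apply_symm_apply] at h1
  have hu : ∀ z, u z = ((C00.of c ξ 𝕜).symm z).sum fun j t => t • v j := fun z => rfl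
  have hU : ∀ z : C00 c ξ 𝕜, ContinuousLinearMap.extend u UniformSpace.Completion.toComplL
      (z : Space c ξ 𝕜) = u z :=
    ContinuousLinearMap.extend_eq u UniformSpace.Completion.denseRange_coe
      (UniformSpace.Completion.isUniformInducing_coe _)
  refine ⟨ContinuousLinearMap.extend u UniformSpace.Completion.toComplL, fun j => ?_,
    fun z => ?_⟩
  · rw [e, hU, hu, LinearEquiv.symm_apply_apply,
      Finsupp.sum_single_index (h := fun j t => t • v j) (zero_smul 𝕜 _),
      one_smul]
  · induction z using UniformSpace.Completion.induction_on with
    | hp =>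
      exact isClosed_le (ContinuousLinearMap.continuous _).norm
        (continuous_const.mul continuous_norm)
    | ih z =>
      rw [hU, UniformSpace.Completion.norm_coe, hu]
      have h1 := h ((C00.of c ξ 𝕜).symm z)
      rwa [norm_sum_smul_e, LinearEquiv.apply_symm_apply] at h1

/-- If averages `S_i` with successive supports are mapped to a subsequence of the basis of `X_ρ`
by a contraction `V` that collapses each support to a point, and if a bounded operator `U` maps
this subsequence back to the averages, then the averages and the indicators of their supports form
a `ρ`-Schreier pair with isometric one-sided estimates. -/
theorem isSchreierPair_of_operators {ρ : Ordinal.{0}} {S : ℕ+ → ℕ+ →₀ ℝ}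
    (hS0 : ∀ i j, 0 ≤ S i j) (hS1 : ∀ i, ((S i).sum fun _ t => t) = 1)
    (hlt : ∀ i j, i < j → ∀ a ∈ (S i).support, ∀ b ∈ (S j).support, a < b)
    {J : ℕ+ → ℕ+} (hJ : StrictMono J) {C : ℝ} {U : Space c ρ 𝕜 →L[𝕜] Space c ξ 𝕜}
    {V : Space c ξ 𝕜 →L[𝕜] Space c ρ 𝕜}
    (hU : ∀ i, U (e c ρ 𝕜 (J i)) = (S i).sum fun j t => (t : 𝕜) • e c ξ 𝕜 j)
    (hU0 : ∀ k, k ∉ Set.range J → U (e c ρ 𝕜 k) = 0) (hUC : ∀ z, ‖U z‖ ≤ C * ‖z‖)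
    (hV : ∀ i, ∀ j ∈ (S i).support, V (e c ξ 𝕜 j) = e c ρ 𝕜 (J i))
    (hV0 : ∀ j, (∀ i, j ∉ (S i).support) → V (e c ξ 𝕜 j) = 0) (hV1 : ∀ z, ‖V z‖ ≤ ‖z‖) :
    IsSchreierPair ρ (fun i => (S i).sum fun j t => (t : 𝕜) • e c ξ 𝕜 j)
      (fun i => ∑ j ∈ (S i).support, f c ξ 𝕜 j) ∧
    IsEllOneSpreadingModel 𝕜 c ρ 1 (fun i => (S i).sum fun j t => (t : 𝕜) • e c ξ 𝕜 j) ∧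
    IsCZeroSpreadingModel 𝕜 c ρ 1 (fun i => ∑ j ∈ (S i).support, f c ξ 𝕜 j) := by
  classical
  set x : ℕ+ → Space c ξ 𝕜 := fun i => (S i).sum fun j t => (t : 𝕜) • e c ξ 𝕜 j with hx
  set x' : ℕ+ → StrongDual 𝕜 (Space c ξ 𝕜) := fun i => ∑ j ∈ (S i).support, f c ξ 𝕜 j with hx'
  have hdisj : ∀ {i k j}, j ∈ (S i).support → j ∈ (S k).support → i = k := by
    intro i k j hi hk
    rcases lt_trichotomy i k with h | h | h
    · exact absurd (hlt i k h j hi j hk) (lt_irrefl j)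
    · exact h
    · exact absurd (hlt k i h j hk j hi) (lt_irrefl j)
  have hx'e : ∀ i j, x' i (e c ξ 𝕜 j) = if j ∈ (S i).support then 1 else 0 := by
    intro i j
    simp only [hx', _root_.sum_apply, f_e, Finset.sum_ite_eq']
  -- Together with `hx'U` this transfers dual estimates: composing with `V` or `U` carries
  -- combinations of `f_{J(i)}` to those of `x' i` and back.
  have hx'V : ∀ i, x' i = (f c ρ 𝕜 (J i)).comp V := by
    refine fun i => continuousLinearMap_ext fun j => ?_
    rw [hx'e, ContinuousLinearMap.comp_apply]
    by_cases h : ∃ k, j ∈ (S k).support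
    · obtain ⟨k, hk⟩ := h
      rw [hV k j hk, f_e]
      refine if_congr ⟨fun h => ?_, fun h => ?_⟩ rfl rfl
      · rw [hdisj h hk]
      · rwa [hJ.injective h]
    · push Not at h
      rw [if_neg (h i), hV0 j h, map_zero]
  have hVx : ∀ i, V (x i) = e c ρ 𝕜 (J i) := by
    intro i
    rw [hx, map_finsuppSum]
    have h1 : ((S i).sum fun j t => V ((t : 𝕜) • e c ξ 𝕜 j)) =
        (((S i).sum fun _ t => t : ℝ) : 𝕜) • e c ρ 𝕜 (J i) := by
      rw [Finsupp.sum, Finsupp.sum, RCLike.ofReal_sum, Finset.sum_smul]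
      exact Finset.sum_congr rfl fun j hj => by rw [map_smul, hV i j hj]
    rw [h1, hS1, RCLike.ofReal_one, one_smul]
  have hx'U : ∀ i, (x' i).comp U = f c ρ 𝕜 (J i) := by
    refine fun i => continuousLinearMap_ext fun k => ?_
    rw [ContinuousLinearMap.comp_apply]
    by_cases h : k ∈ Set.range J
    · obtain ⟨l, rfl⟩ := h
      rw [hU l, hx'V i, ContinuousLinearMap.comp_apply]
      exact congrArg _ (hVx l)
    · rw [hU0 k h, map_zero, f_e, if_neg]
      rintro rfl
      exact h ⟨i, rfl⟩
  have hx'x : ∀ i k, x' i (x k) = if i = k then 1 else 0 := by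
    intro i k
    rw [hx'V, ContinuousLinearMap.comp_apply, hVx, f_e]
    exact if_congr hJ.injective.eq_iff rfl rfl
  have hxn : ∀ i, ‖x i‖ = 1 := by
    refine fun i => le_antisymm ?_ ?_
    · refine (norm_sum_le _ _).trans_eq ?_
      rw [← hS1 i]
      refine Finset.sum_congr rfl fun j _ => ?_
      rw [norm_smul, norm_e, mul_one, RCLike.norm_ofReal, abs_of_nonneg (hS0 i j)]
    · have h1 := hV1 (x i)
      rwa [hVx, norm_e] at h1
  have hVn : ‖V‖ ≤ 1 := V.opNorm_le_bound zero_le_one fun z => by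
    rw [one_mul]
    exact hV1 z
  have hx'n : ∀ i, ‖x' i‖ = 1 := by
    refine fun i => le_antisymm ?_ ?_
    · rw [hx'V]
      exact (ContinuousLinearMap.opNorm_comp_le _ _).trans
        (mul_le_one₀ (norm_f_le _) (norm_nonneg _) hVn)
    · have h1 := (x' i).le_opNorm (x i)
      rwa [hx'x, if_pos rfl, norm_one, hxn, mul_one] at h1
  have hmem : ∀ (i : ℕ+) (j : ℕ+), j ∈ (S i).support →
      e c ξ 𝕜 j ∈ Submodule.span 𝕜 (e c ξ 𝕜 '' ((S i).support : Set ℕ+)) := fun i j hj =>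
    Submodule.subset_span ⟨j, hj, rfl⟩
  have hxU : ∀ a : ℕ+ →₀ 𝕜,
      (a.sum fun i t => t • x i) = U (a.sum fun i t => t • e c ρ 𝕜 (J i)) := by
    intro a
    simp only [map_finsuppSum_smul, hU, hx]
  have hJle : ∀ i, i ≤ J i := fun i => hJ.le_apply
  have hJmem : ∀ {E}, E ∈ schreier c ρ → E.image J ∈ schreier c ρ := fun {E} hE =>
    image_mem_schreier (Φ := id) (by rwa [Finset.image_id]) (strictMono_id.strictMonoOn _)
      (hJ.strictMonoOn _) fun i _ => hJle i
  have hmod : ∀ i, modulus (x i) = x i := by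
    intro i
    let y : C00 c ξ 𝕜 := C00.of c ξ 𝕜 ((S i).mapRange (fun t : ℝ => (t : 𝕜)) (by simp))
    have hy : x i = (y : Space c ξ 𝕜) := by
      rw [coe_eq_sum, LinearEquiv.symm_apply_apply]
      exact (Finsupp.sum_mapRange_index (h := fun j t => t • e c ξ 𝕜 j)
        fun j => zero_smul 𝕜 _).symm
    rw [hy, modulus, UniformSpace.Completion.map_coe C00.uniformContinuous_modulus]
    congr 1
    refine DFunLike.ext _ _ fun j => ?_
    have hyj : y j = ((S i j : ℝ) : 𝕜) := Finsupp.mapRange_apply (hf := by simp) ..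
    rw [C00.modulus_apply, hyj, RCLike.norm_ofReal, abs_of_nonneg (hS0 i j)]
  have hdmod : ∀ i, dualModulus (x' i) = x' i := by
    refine fun i => continuousLinearMap_ext fun j => ?_
    rw [dualModulus_e, hx'e]
    split_ifs <;> simp
  refine ⟨⟨⟨fun i => (S i).support, hlt, fun i => ⟨fun h => ?_, ?_⟩⟩, hxn,
    ⟨fun i => (S i).support, hlt, fun i => ⟨fun h => ?_, ?_⟩⟩, hx'n, fun i j hij => ?_,
    fun i => ?_, ⟨1, one_pos, fun i => ?_⟩, ⟨J, hJ, ⟨⟨C, fun a => ?_⟩, 1, fun a => ?_⟩,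
      ⟨1, fun a => ?_⟩, C, fun a => ?_⟩, ⟨C, fun n => ?_⟩⟩, ⟨?_, fun E hE a ha => ?_⟩,
    ⟨?_, fun E hE a ha => ?_⟩⟩
  · have h1 := hxn i
    rw [h, norm_zero] at h1
    exact zero_ne_one h1
  · exact Submodule.sum_mem _ fun j hj => Submodule.smul_mem _ _ (hmem i j hj)
  · have h1 := hx'n i
    rw [h, norm_zero] at h1
    exact zero_ne_one h1
  · exact Submodule.sum_mem _ fun j hj => Submodule.subset_span ⟨j, hj, rfl⟩
  · rw [hx'x, if_neg hij]
  · rw [hdmod, hmod, hx'x, if_pos rfl, RCLike.one_re, RCLike.ofReal_one]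
  · rw [hx'x, if_pos rfl, RCLike.one_re]
  · rw [hxU]
    exact hUC _
  · have h1 : (a.sum fun i t => t • e c ρ 𝕜 (J i)) = V (a.sum fun i t => t • x i) := by
      simp only [map_finsuppSum_smul, hVx]
    rw [h1, one_mul]
    exact hV1 _
  · have h1 : (a.sum fun i t => t • x' i) = (a.sum fun i t => t • f c ρ 𝕜 (J i)).comp V := by
      rw [Finsupp.sum, Finsupp.sum, ContinuousLinearMap.finsetSum_comp]
      exact Finset.sum_congr rfl fun i _ => by rw [ContinuousLinearMap.smul_comp, hx'V]
    rw [h1, one_mul]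
    exact (ContinuousLinearMap.opNorm_comp_le _ _).trans
      (mul_le_of_le_one_right (norm_nonneg _) hVn)
  · have h1 : (a.sum fun i t => t • f c ρ 𝕜 (J i)) = (a.sum fun i t => t • x' i).comp U := by
      rw [Finsupp.sum, Finsupp.sum, ContinuousLinearMap.finsetSum_comp]
      exact Finset.sum_congr rfl fun i _ => by rw [ContinuousLinearMap.smul_comp, hx'U]
    have hC : 0 ≤ C := by
      have h2 := (norm_nonneg _).trans (hUC (e c ρ 𝕜 1))
      rwa [norm_e, mul_one] at h2
    rw [h1, mul_comm]
    exact (ContinuousLinearMap.opNorm_comp_le _ _).trans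
      (mul_le_mul_of_nonneg_left (U.opNorm_le_bound hC hUC) (norm_nonneg _))
  · have hC : 0 ≤ C := by
      have h2 := (norm_nonneg _).trans (hUC (e c ρ 𝕜 1))
      rwa [norm_e, mul_one] at h2
    refine ContinuousLinearMap.opNorm_le_bound _ hC fun y => ?_
    -- The finite rank operator factors as `V`, then a coordinate projection of `X_ρ`, then `U`.
    have h1 : (∑ i ∈ Finset.Icc 1 n, (x' i).smulRight (x i)) y =
        U (∑ k ∈ (Finset.Icc 1 n).image J, f c ρ 𝕜 k (V y) • e c ρ 𝕜 k) := by
      rw [Finset.sum_image hJ.injective.injOn, map_sum, _root_.sum_apply]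
      refine Finset.sum_congr rfl fun i _ => ?_
      rw [map_smul, hU, ContinuousLinearMap.smulRight_apply, hx'V]
      rfl
    rw [h1]
    exact (hUC _).trans (mul_le_mul_of_nonneg_left
      ((norm_sum_f_smul_e_le _ _).trans (hV1 y)) hC)
  · exact ⟨1, 1, one_pos, fun i => ⟨(hxn i).ge, (hxn i).le⟩⟩
  -- `V` turns the sum into a combination of the `e_{J(i)}`, whose norm is tested on the image of
  -- `E` under `J`, a spreading of `E`.
  · refine le_trans ?_ (hV1 _)
    refine le_trans ?_ (sum_norm_f_le (hJmem hE) _)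
    rw [← ha, Finset.sum_image hJ.injective.injOn]
    refine Finset.sum_le_sum fun i hi => ?_
    simp only [map_sum, map_smul, hVx, f_e, smul_eq_mul, mul_ite, mul_one, mul_zero,
      hJ.injective.eq_iff, Finset.sum_ite_eq, if_pos hi]
    exact le_rfl
  · exact ⟨1, 1, one_pos, fun i => ⟨(hx'n i).ge, (hx'n i).le⟩⟩
  · refine ContinuousLinearMap.opNorm_le_bound _ zero_le_one fun y => ?_
    rw [one_mul]
    refine le_trans ?_ ((sum_norm_f_le (hJmem hE) (V y)).trans (hV1 y))
    rw [_root_.sum_apply, Finset.sum_image hJ.injective.injOn]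
    refine (norm_sum_le _ _).trans (Finset.sum_le_sum fun i hi => ?_)
    rw [_root_.smul_apply, norm_smul, hx'V, ContinuousLinearMap.comp_apply]
    exact mul_le_of_le_one_left (norm_nonneg _) (ha i hi)

end

/-! ### Bounds for the two operators. -/

section

variable {ξ ι ρ : Ordinal.{0}} {𝕜 : Type*} [RCLike 𝕜]

/-- Vectors in the span come from `c_00`, where the norm is the supremum over `S_ξ` by definition.
-/
theorem norm_le_of_mem_span {z : Space c ξ 𝕜} {C : ℝ}
    (hz : z ∈ Submodule.span 𝕜 (Set.range (e c ξ 𝕜)))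
    (h : ∀ E ∈ schreier c ξ, ∑ j ∈ E, ‖f c ξ 𝕜 j z‖ ≤ C) : ‖z‖ ≤ C := by
  have h1 : Submodule.span 𝕜 (Set.range (e c ξ 𝕜)) ≤
      LinearMap.range (UniformSpace.Completion.toComplL (𝕜 := 𝕜) (E := C00 c ξ 𝕜)).toLinearMap := by
    rw [Submodule.span_le]
    rintro _ ⟨j, rfl⟩
    exact ⟨_, rfl⟩
  obtain ⟨y, rfl⟩ := h1 hz
  change ‖(y : Space c ξ 𝕜)‖ ≤ C
  rw [UniformSpace.Completion.norm_coe]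
  refine C00.norm_le fun E hE => le_of_eq_of_le (Finset.sum_congr rfl fun j _ => ?_) (h E hE)
  exact congrArg _ (f_coe j y).symm

/-- Collapsing sets of indices along `K` is a contraction from `X_ξ` to `X_ρ` if preimages of
members of `S_ρ` belong to `S_ξ`. -/
theorem isDominatedWith_collapse (P : ℕ+ → Prop) [DecidablePred P] (K : ℕ+ → ℕ+)
    (h : ∀ E ∈ schreier c ρ, ∀ H : Finset ℕ+, (∀ j ∈ H, P j ∧ K j ∈ E) → H ∈ schreier c ξ) :
    IsDominatedWith 𝕜 1 (fun j => if P j then e c ρ 𝕜 (K j) else 0) (e c ξ 𝕜) := by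
  classical
  intro a
  rw [one_mul, norm_sum_smul_e]
  refine norm_le_of_mem_span ?_ fun E hE => ?_
  · refine Submodule.sum_mem _ fun j _ => Submodule.smul_mem _ _ ?_
    beta_reduce
    split_ifs
    · exact Submodule.subset_span ⟨_, rfl⟩
    · exact Submodule.zero_mem _
  · have h1 : ∀ k, ‖f c ρ 𝕜 k (a.sum fun j t => t • if P j then e c ρ 𝕜 (K j) else 0)‖ ≤
        ∑ j ∈ a.support, if k = K j then (if P j then ‖a j‖ else 0) else 0 := by
      intro k
      rw [map_finsuppSum_smul]
      refine (norm_sum_le _ _).trans (Finset.sum_le_sum fun j _ => ?_)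
      by_cases hP : P j
      · simp only [if_pos hP, f_e]
        split_ifs <;> simp
      · simp [hP]
    refine (Finset.sum_le_sum fun k _ => h1 k).trans ?_
    rw [Finset.sum_comm]
    simp only [Finset.sum_ite_eq']
    have h2 := C00.sum_le_norm (C00.of c ξ 𝕜 a)
      (h E hE {j ∈ a.support | P j ∧ K j ∈ E} fun j hj => (Finset.mem_filter.1 hj).2)
    refine le_trans (le_of_eq ?_) h2
    rw [Finset.sum_filter]
    refine Finset.sum_congr rfl fun j _ => ?_
    rw [C00.of_apply]
    by_cases h3 : P j <;> by_cases h4 : K j ∈ E <;> simp [h3, h4]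

/-- Finitely supported nonnegative functions `S_n`, whose masses on members of `S_ξ` are
controlled by the indicator of a member of `S_ρ` up to a summable error, are dominated by a
subsequence of the basis of `X_ρ`. -/
theorem isDominatedWith_of_mass_le {S : ℕ → ℕ+ →₀ ℝ} (hS : ∀ n j, 0 ≤ S n j) {J : ℕ → ℕ+}
    (hJ : Function.Injective J)
    (hmass : ∀ G ∈ schreier c ξ, ∃ P Q : ℕ → Prop,
      (∀ H : Finset ℕ, (∀ n ∈ H, P n) → H.image J ∈ schreier c ρ) ∧
      (∀ n m, Q n → Q m → n = m) ∧
      ∀ n, (∑ j ∈ G, S n j ≤ 1 ∧ (P n ∨ Q n)) ∨ ∑ j ∈ G, S n j ≤ (1 / 2) ^ (n + 1))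
    {u : ℕ+ → Space c ξ 𝕜} (hu : ∀ n, u (J n) = (S n).sum fun j t => (t : 𝕜) • e c ξ 𝕜 j)
    (hu0 : ∀ k, k ∉ Set.range J → u k = 0) :
    IsDominatedWith 𝕜 3 u (e c ρ 𝕜) := by
  classical
  intro a
  rw [norm_sum_smul_e]
  set y := C00.of c ρ 𝕜 a with hy
  refine norm_le_of_mem_span ?_ fun G hG => ?_
  · refine Submodule.sum_mem _ fun k _ => Submodule.smul_mem _ _ ?_
    by_cases hk : k ∈ Set.range J
    · obtain ⟨n, rfl⟩ := hk
      rw [hu]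
      exact Submodule.sum_mem _ fun j _ => Submodule.smul_mem _ _ (Submodule.subset_span ⟨j, rfl⟩)
    · rw [hu0 k hk]
      exact Submodule.zero_mem _
  obtain ⟨P, Q, hP, hQ, hPQ⟩ := hmass G hG
  have h1 : ∀ n j, ‖f c ξ 𝕜 j (u (J n))‖ = S n j := by
    intro n j
    rw [hu, map_finsuppSum]
    simp only [map_smul, f_e, smul_eq_mul, mul_ite, mul_one, mul_zero, Finsupp.sum_ite_eq]
    split_ifs with h
    · rw [RCLike.norm_ofReal, abs_of_nonneg (hS n j)]
    · rw [norm_zero, Finsupp.notMem_support_iff.1 h]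
  set H := a.support.preimage J hJ.injOn with hH
  have h2 : ∑ j ∈ G, ‖f c ξ 𝕜 j (a.sum fun k t => t • u k)‖ ≤
      ∑ n ∈ H, ‖y (J n)‖ * ∑ j ∈ G, S n j := by
    have h3 : ∀ j, ‖f c ξ 𝕜 j (a.sum fun k t => t • u k)‖ ≤
        ∑ k ∈ a.support, ‖a k‖ * ‖f c ξ 𝕜 j (u k)‖ := fun j => by
      rw [map_finsuppSum_smul]
      refine (norm_sum_le _ _).trans (Finset.sum_le_sum fun k _ => ?_)
      exact (norm_smul_le _ _)
    refine (Finset.sum_le_sum fun j _ => h3 j).trans ?_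
    rw [Finset.sum_comm]
    rw [← Finset.sum_preimage J a.support hJ.injOn]
    · refine Finset.sum_le_sum fun n _ => ?_
      rw [Finset.mul_sum]
      exact Finset.sum_le_sum fun j _ => by rw [h1, hy, C00.of_apply]
    · intro k _ hk
      simp [hu0 k hk]
  refine h2.trans ?_
  -- Summed over `n`, each of the three terms is at most `‖y‖`: the first because the indices with
  -- `P` form a member of `S_ρ`, the second by the geometric series, the third because `Q` holds at
  -- most once. Hence the constant `3`.
  have h3 : ∀ n ∈ H, ‖y (J n)‖ * ∑ j ∈ G, S n j ≤ (if P n then ‖y (J n)‖ else 0) +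
      ‖y‖ * (1 / 2) ^ (n + 1) + ‖y‖ * (if Q n then 1 else 0) := by
    intro n _
    have h4 := C00.norm_apply_le y (J n)
    have h5 : 0 ≤ ‖y (J n)‖ := norm_nonneg _
    have h6 : 0 ≤ ‖y‖ := norm_nonneg _
    have h7 : (0 : ℝ) ≤ (1 / 2) ^ (n + 1) := by positivity
    have h8 := mul_nonneg h6 h7
    rcases hPQ n with ⟨h9, h10 | h10⟩ | h9
    · rw [if_pos h10]
      have h11 := mul_le_of_le_one_right h5 h9
      split_ifs <;> linarith
    · rw [if_pos h10]
      have h11 := mul_le_of_le_one_right h5 h9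
      split_ifs <;> linarith
    · have h11 := mul_le_mul h4 h9 (Finset.sum_nonneg fun j _ => hS n j) h6
      split_ifs <;> linarith
  refine (Finset.sum_le_sum h3).trans ?_
  rw [Finset.sum_add_distrib, Finset.sum_add_distrib, ← Finset.mul_sum, ← Finset.mul_sum,
    ← Finset.sum_filter]
  have hsub : H ⊆ Finset.range (H.sup id + 1) := Finset.subset_range_sup_succ H
  have h4 : ∑ n ∈ H with P n, ‖y (J n)‖ ≤ ‖y‖ := by
    rw [← Finset.sum_image (f := fun k => ‖y k‖) hJ.injOn]
    exact C00.sum_le_norm y (hP _ fun n hn => (Finset.mem_filter.1 hn).2)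
  have h5 : ∑ n ∈ H, (1 / 2 : ℝ) ^ (n + 1) ≤ 1 :=
    (Finset.sum_le_sum_of_subset_of_nonneg hsub fun _ _ _ => by positivity).trans
      (sum_half_pow_succ_le_one _)
  have h6 : ∑ n ∈ H, (if Q n then (1 : ℝ) else 0) ≤ 1 :=
    (Finset.sum_le_sum_of_subset_of_nonneg hsub fun _ _ _ => by positivity).trans
      (sum_indicator_le_one Q hQ)
  have h7 := mul_le_of_le_one_right (norm_nonneg y) h5
  have h8 := mul_le_of_le_one_right (norm_nonneg y) h6
  linarith

/-- The masses of the successive averages of order `ι` on a member of `S_{ι + ρ}` are controlled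
by the indicator of a member of `S_ρ`, up to a summable error and one further term. -/
theorem exists_mass_le (hι : ι < ω₁) {M : Set ℕ+} (hM : M.Infinite) (hs : IsSparse M)
    {Φ : ℕ+ → ℕ+} (hΦ : StrictMono Φ)
    (hdec : ∀ G ∈ schreier c ξ, ∃ μ : ℕ+ → ℕ+,
      (∀ a ∈ G, μ a ∈ G ∧ μ a ≤ a ∧ μ (μ a) = μ a) ∧ MonotoneOn μ G ∧
      (∀ v, {a ∈ G | μ a = v} ∈ schreier c ι) ∧ (G.image μ).image Φ ∈ schreier c ρ)
    {J : ℕ → ℕ+} (hJ : StrictMono J)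
    (hJΦ : ∀ n, ∀ t ∈ M, t < least (remainder (firstAverage c ι) M n) → Φ t ≤ J n)
    {G : Finset ℕ+} (hG : G ∈ schreier c ξ) :
    ∃ P Q : ℕ → Prop, (∀ H : Finset ℕ, (∀ n ∈ H, P n) → H.image J ∈ schreier c ρ) ∧
      (∀ n m, Q n → Q m → n = m) ∧
      ∀ n, (∑ j ∈ G, firstAverage c ι (remainder (firstAverage c ι) M n) j ≤ 1 ∧ (P n ∨ Q n)) ∨
        ∑ j ∈ G, firstAverage c ι (remainder (firstAverage c ι) M n) j ≤ (1 / 2) ^ (n + 1) := by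
  classical
  have hA := isAveraging_firstAverage c ι
  set A := firstAverage c ι with hAdef
  -- Points outside `M` carry no mass; dropping them puts all minima into `M`, where `hJΦ` and
  -- sparseness apply.
  obtain ⟨μ, hμ, hmono, hfib, him⟩ := hdec {a ∈ G | a ∈ M}
    (mem_schreier_of_subset hG (Finset.filter_subset _ _))
  set G₀ : Finset ℕ+ := {a ∈ G | a ∈ M} with hG₀
  have hmemM : ∀ t ∈ G₀.image μ, t ∈ G₀ ∧ t ∈ M ∧ μ t = t := by
    intro t ht
    obtain ⟨b, hb, rfl⟩ := Finset.mem_image.1 ht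
    obtain ⟨h1, -, h2⟩ := hμ b hb
    exact ⟨h1, (Finset.mem_filter.1 h1).2, h2⟩
  have hmax : ∀ n, (∃ t ∈ G₀.image μ, t < least (remainder A M n)) → ∃ t ∈ G₀.image μ,
      t < least (remainder A M n) ∧
      ∀ s ∈ G₀.image μ, s < least (remainder A M n) → s ≤ t := by
    rintro n ⟨t, ht, htn⟩
    obtain ⟨m, hm, h⟩ := Finset.exists_max_image
      {t ∈ G₀.image μ | t < least (remainder A M n)} id ⟨t, Finset.mem_filter.2 ⟨ht, htn⟩⟩
    obtain ⟨h1, h2⟩ := Finset.mem_filter.1 hm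
    exact ⟨m, h1, h2, fun s hs hsn => h s (Finset.mem_filter.2 ⟨hs, hsn⟩)⟩
  refine ⟨fun n => (∃ s ∈ G₀.image μ, s ∈ (A (remainder A M n)).support) ∧
    ∃ t ∈ G₀.image μ, t < least (remainder A M n), fun n =>
    (∃ a ∈ G₀, a ∈ (A (remainder A M n)).support) ∧
    ∀ t ∈ G₀.image μ, ¬ t < least (remainder A M n), fun H hH => ?_, ?_, fun n => ?_⟩
  -- `τ n` is the last minimum before block `n`. A block in `H` contains a minimum, which is at most
  -- `τ m` for each later `m` in `H`; so `τ` is strictly increasing on `H`, and `Φ (τ n) ≤ J n`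
  -- allows spreading.
  · choose! τ h1 h2 h3 using hmax
    refine image_mem_schreier (Φ := fun n => Φ (τ n)) (mem_schreier_of_subset him ?_) ?_
      (hJ.strictMonoOn _) fun n hn => hJΦ n _ (hmemM _ (h1 n (hH n hn).2)).2.1 (h2 n (hH n hn).2)
    · intro k hk
      obtain ⟨n, hn, rfl⟩ := Finset.mem_image.1 hk
      exact Finset.mem_image_of_mem Φ (h1 n (hH n hn).2)
    · intro n hn m hm hnm
      obtain ⟨⟨s, hs1, hs2⟩, h4⟩ := hH n hn
      refine hΦ ((h2 n h4).trans_le ?_)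
      refine (least_le (hA.support_subset_remainder hM n hs2)).trans ?_
      exact h3 m (hH m hm).2 s hs1
        (hA.support_lt hM hnm hs2 (hA.least_remainder_mem hM m))
  -- If `G₀` meets block `n` in `a`, then the minimum `μ a ≤ a` precedes every later block, so `Q`
  -- fails there.
  · have h : ∀ n m, n < m → (∃ a ∈ G₀, a ∈ (A (remainder A M n)).support) →
        ¬ ∀ t ∈ G₀.image μ, ¬ t < least (remainder A M m) := by
      rintro n m hnm ⟨a, ha, han⟩ h
      refine h (μ a) (Finset.mem_image_of_mem μ ha) ((hμ a ha).2.1.trans_lt ?_)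
      exact hA.support_lt hM hnm han (hA.least_remainder_mem hM m)
    intro n m hn hm
    rcases lt_trichotomy n m with h1 | h1 | h1
    · exact absurd hm.2 (h n m h1 hn.1)
    · exact h1
    · exact absurd hn.2 (h m n h1 hm.1)
  · have hinf := remainder_infinite (A := A) hM n
    have hle := hA.sum_le_one hinf G
    by_cases h1 : ∃ t ∈ G₀.image μ, t < least (remainder A M n)
    · by_cases h2 : ∃ s ∈ G₀.image μ, s ∈ (A (remainder A M n)).support
      · exact Or.inl ⟨hle, Or.inl ⟨h2, h1⟩⟩
      · push Not at h2
        obtain ⟨t, ht, htn, hmaxt⟩ := hmax n h1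
        obtain ⟨htG, htM, hμt⟩ := hmemM t ht
        refine Or.inr ?_
        -- With no minimum inside the block, all of `G` in it belongs to the piece of the last
        -- minimum `t` before it.
        have h3 : ∑ j ∈ G, A (remainder A M n) j =
            ∑ j ∈ G₀ with μ j = t, A (remainder A M n) j := by
          refine (Finset.sum_subset (fun a ha => ?_) fun a ha hna => ?_).symm
          · exact (Finset.mem_filter.1 (Finset.mem_filter.1 ha).1).1
          · by_contra h0
            have hsupp := Finsupp.mem_support_iff.2 h0
            have haM := hA.support_subset hM n hsupp
            have haG : a ∈ G₀ := Finset.mem_filter.2 ⟨ha, haM⟩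
            have hμa := Finset.mem_image_of_mem μ haG
            refine hna (Finset.mem_filter.2 ⟨haG, le_antisymm (hmaxt _ hμa ?_) ?_⟩)
            · by_contra! h4
              refine h2 _ hμa (hA.initial _ hinf _ ?_ a hsupp (hμ a haG).2.1)
              exact hA.mem_remainder_of_le hM (hmemM _ hμa).2.1 (least_mem hinf.nonempty) h4
            · rw [← hμt]
              refine hmono htG haG (htn.le.trans ?_)
              exact least_le (hA.support_subset_remainder hM n hsupp)
        rw [h3]
        exact (sum_firstAverage_le c hι hinf (hs.mono (remainder_subset n)) (hfib t)
          (Finset.mem_filter.2 ⟨htG, hμt⟩) htn).trans (hA.div_least_le_half_pow hM hs htM htn)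
    · push Not at h1
      by_cases h2 : ∃ a ∈ G₀, a ∈ (A (remainder A M n)).support
      · exact Or.inl ⟨hle, Or.inr ⟨h2, fun t ht => (h1 t ht).not_gt⟩⟩
      · push Not at h2
        refine Or.inr (le_of_eq_of_le (Finset.sum_eq_zero fun a ha => ?_) (by positivity))
        by_contra h0
        have hsupp := Finsupp.mem_support_iff.2 h0
        exact h2 a (Finset.mem_filter.2 ⟨ha, hA.support_subset hM n hsupp⟩) hsupp

/-! ### Choice of the set and of the block indices; conclusion. -/

theorem exists_sparse_subset (g : ℕ+ → ℕ+) (b : ℕ+) {L : Set ℕ+} (hL : L.Infinite) :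
    ∃ M ⊆ L, M.Infinite ∧ (∀ a ∈ M, b < a) ∧ ∀ x ∈ M, ∀ y ∈ M, x < y → g x ≤ y := by
  obtain ⟨s, h1, h2⟩ := exists_seq_of_forall_finset_exists (fun y => y ∈ L ∧ b < y)
    (fun x y => x < y ∧ g x ≤ y) fun s _ => by
      obtain ⟨y, hy, h⟩ := hL.exists_gt (max b (s.sup fun x => max x (g x)))
      have h3 : ∀ x ∈ s, max x (g x) < y := fun x hx =>
        (Finset.le_sup (f := fun x => max x (g x)) hx).trans_lt ((le_max_right _ _).trans_lt h)
      exact ⟨y, ⟨hy, (le_max_left _ _).trans_lt h⟩, fun x hx =>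
        ⟨(le_max_left _ _).trans_lt (h3 x hx), ((le_max_right _ _).trans_lt (h3 x hx)).le⟩⟩
  have hmono : StrictMono s := fun m n h => (h2 m n h).1
  refine ⟨Set.range s, ?_, Set.infinite_range_of_injective hmono.injective, ?_, ?_⟩
  · rintro _ ⟨n, rfl⟩
    exact (h1 n).1
  · rintro _ ⟨n, rfl⟩
    exact (h1 n).2
  · rintro _ ⟨m, rfl⟩ _ ⟨n, rfl⟩ h
    exact (h2 m n (hmono.lt_iff_lt.1 h)).2

/-- Members of `S_ρ` in the indices of the blocks unite blocks of order `ι` to a member of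
`S_{ι + ρ}`. -/
theorem mem_schreier_of_blocks {A : Set ℕ+ → ℕ+ →₀ ℝ} (hA : IsAveraging A) {M : Set ℕ+}
    (hM : M.Infinite) (hsupp : ∀ n, (A (remainder A M n)).support ∈ schreier c ι)
    {T : ℕ+ → ℕ+} (hT : ∀ (E : Finset ℕ+) (π : ℕ+ → ℕ+), MonotoneOn π E →
      (∀ v, {a ∈ E | π a = v} ∈ schreier c ι) → E.image π ∈ schreier c ρ →
      (∀ a ∈ E, T (π a) ≤ a) → E ∈ schreier c ξ)
    {J : ℕ → ℕ+} (hJ : StrictMono J)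
    (hTJ : ∀ n, ∀ a ∈ (A (remainder A M n)).support, T (J n) ≤ a)
    {N : ℕ+ → ℕ} {E H : Finset ℕ+} (hE : E ∈ schreier c ρ)
    (hH : ∀ j ∈ H, j ∈ (A (remainder A M (N j))).support ∧ J (N j) ∈ E) : H ∈ schreier c ξ := by
  classical
  refine hT H (fun j => J (N j)) (fun a ha b hb hab => hJ.monotone ?_) (fun v => ?_) ?_
    fun a ha => hTJ _ a (hH a ha).1
  · by_contra! h
    exact hab.not_gt (hA.support_lt hM h (hH b hb).1 (hH a ha).1)
  · by_cases hv : ∃ n, J n = v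
    · obtain ⟨n, rfl⟩ := hv
      refine mem_schreier_of_subset (hsupp n) fun a ha => ?_
      obtain ⟨h1, h2⟩ := Finset.mem_filter.1 ha
      rw [← hJ.injective h2]
      exact (hH a h1).1
    · rw [Finset.filter_eq_empty_iff.2 fun a _ h => hv ⟨_, h⟩]
      exact empty_mem_schreier c ι
  · refine mem_schreier_of_subset hE fun k hk => ?_
    obtain ⟨a, ha, rfl⟩ := Finset.mem_image.1 hk
    exact (hH a ha).2

end

end SchreierSpaces

theorem mainTheorem3 (𝕜 : Type*) [RCLike 𝕜] (c : SchreierSpaces.System) (ξ ι : Ordinal.{0})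
    (hξ : ξ < Ordinal.omega 1) (hι : ι ≤ ξ) (L : Set ℕ+) (hL : L.Infinite) :
    ∃ M : Set ℕ+, M ⊆ L ∧ M.Infinite ∧
      SchreierSpaces.IsSchreierPair (ξ - ι)
        (SchreierSpaces.averageVector c ξ 𝕜 ι M) (SchreierSpaces.supportFunctional c ξ 𝕜 ι M) ∧
      SchreierSpaces.IsEllOneSpreadingModel 𝕜 c (ξ - ι) 1
        (SchreierSpaces.averageVector c ξ 𝕜 ι M) ∧
      SchreierSpaces.IsCZeroSpreadingModel 𝕜 c (ξ - ι) 1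
        (SchreierSpaces.supportFunctional c ξ 𝕜 ι M) := by
  classical
  open SchreierSpaces in
  obtain ⟨ρ, rfl⟩ : ∃ ρ, ξ = ι + ρ := ⟨ξ - ι, (Ordinal.add_sub_cancel_of_le hι).symm⟩
  rw [Ordinal.add_sub_cancel]
  obtain ⟨T, -, hT⟩ := exists_union_mem_schreier_add (c := c) ι ρ hξ
  obtain ⟨Φ, hΦ, hdec⟩ := exists_decomposition_of_mem_schreier_add (c := c) ι ρ hξ
  -- The first entry of the maximum gives the mass bounds, the second leaves room to unite blocks;
  -- starting beyond `T 1` serves block `0`, whose index is `1`.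
  obtain ⟨M, hML, hM, hM1, hMg⟩ := exists_sparse_subset
    (fun a => max ⟨2 ^ ((a : ℕ) + 2) * a, by positivity⟩ (T (Φ a))) (T 1) hL
  have hs : IsSparse M := fun a ha b hb hab =>
    (PNat.coe_le_coe _ _).2 ((le_max_left _ _).trans (hMg a ha b hb hab))
  have hMT : ∀ a ∈ M, ∀ b ∈ M, a < b → T (Φ a) ≤ b := fun a ha b hb hab =>
    (le_max_right _ _).trans (hMg a ha b hb hab)
  have hA := isAveraging_firstAverage c ι
  set A := firstAverage c ι with hAdef
  have hne : ∀ n, (A (remainder A M n)).support.Nonempty := fun n =>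
    ⟨_, hA.least_remainder_mem hM n⟩
  let top : ℕ → ℕ+ := fun n => (A (remainder A M n)).support.max' (hne n)
  have htop : ∀ n, top n ∈ (A (remainder A M n)).support := fun n => Finset.max'_mem _ _
  have hltop : ∀ n, ∀ a ∈ (A (remainder A M n)).support, a ≤ top n := fun n a ha =>
    Finset.le_max' _ a ha
  have htopM : ∀ n, top n ∈ M := fun n => hA.support_subset hM n (htop n)
  -- The shift by one block balances two demands: `J n` dominates `Φ t` for every `t ∈ M` before
  -- block `n`, yet depends only on points before block `n`, so that `T (J n)` can stay below the
  -- block.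
  let J : ℕ → ℕ+ := fun n => Nat.casesOn n 1 fun n => Φ (top n)
  have hJ : StrictMono J := by
    refine strictMono_nat_of_lt_succ fun n => ?_
    cases n with
    | zero => exact (one_le.trans_lt (hM1 _ (htopM 0))).trans_le hΦ.le_apply
    | succ n => exact hΦ (hA.support_lt hM n.lt_succ_self (htop n) (htop (n + 1)))
  have hTJ : ∀ n, ∀ a ∈ (A (remainder A M n)).support, T (J n) ≤ a := by
    intro n a ha
    cases n with
    | zero => exact (hM1 a (hA.support_subset hM 0 ha)).le
    | succ n =>
      exact hMT _ (htopM n) a (hA.support_subset hM (n + 1) ha)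
        (hA.support_lt hM n.lt_succ_self (htop n) ha)
  have hJΦ : ∀ n, ∀ t ∈ M, t < least (remainder A M n) → Φ t ≤ J n := by
    intro n t ht htn
    cases n with
    | zero => exact absurd (least_le ht) htn.not_ge
    | succ n =>
      obtain ⟨k, hk, htk⟩ := exists_mem_support_of_notMem_remainder ht fun h =>
        (least_le h).not_gt htn
      refine hΦ.monotone ?_
      rcases (Nat.lt_succ_iff.1 hk).lt_or_eq with h | rfl
      · exact (hA.support_lt hM h htk (htop n)).le
      · exact hltop k t htk
  have hsupp : ∀ n, (A (remainder A M n)).support ∈ schreier c ι := fun n =>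
    support_firstAverage_mem_schreier c ι (remainder_infinite hM n)
  have hN : ∀ j, (∃ n, j ∈ (A (remainder A M n)).support) →
      ∃ n, j ∈ (A (remainder A M n)).support := fun _ h => h
  choose! N hN using hN
  have hV := isDominatedWith_collapse (𝕜 := 𝕜) (c := c) (ξ := ι + ρ) (ρ := ρ)
    (fun j => ∃ n, j ∈ (A (remainder A M n)).support) (fun j => J (N j)) fun E hE H hH =>
      mem_schreier_of_blocks hA hM hsupp hT hJ hTJ hE fun j hj => ⟨hN j (hH j hj).1, (hH j hj).2⟩
  obtain ⟨V, hV, hV1⟩ := hV.exists_operator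
  let u : ℕ+ → Space c (ι + ρ) 𝕜 := fun k => if k ∈ Set.range J then
    (A (remainder A M (Function.invFun J k))).sum fun j t => (t : 𝕜) • e c (ι + ρ) 𝕜 j else 0
  have hu : ∀ n, u (J n) =
      (A (remainder A M n)).sum fun j t => (t : 𝕜) • e c (ι + ρ) 𝕜 j := fun n => by
    simp only [u]
    rw [if_pos ⟨n, rfl⟩, Function.leftInverse_invFun hJ.injective n]
  have hu0 : ∀ k, k ∉ Set.range J → u k = 0 := fun k hk => if_neg hk
  have hι1 : ι < Ordinal.omega 1 := hι.trans_lt hξ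
  obtain ⟨U, hU, hUC⟩ := (isDominatedWith_of_mass_le (ρ := ρ)
    (fun n j => hA.nonneg _ (remainder_infinite hM n) j) hJ.injective
    (fun G hG => exists_mass_le hι1 hM hs hΦ hdec hJ hJΦ hG) hu hu0).exists_operator
  -- Blocks are numbered from `0` in `remainder` and from `1` in `average`.
  have hpred : StrictMono PNat.natPred := PNat.natPred_strictMono
  refine ⟨M, hML, hM, isSchreierPair_of_operators (S := average c ι M) (C := 3) (U := U) (V := V)
    (J := fun i => J i.natPred)
    (fun i j => hA.nonneg _ (remainder_infinite hM _) j)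
    (fun i => hA.sum_eq_one _ (remainder_infinite hM _))
    (fun i j hij a ha b hb => hA.support_lt hM (hpred hij) ha hb) (hJ.comp hpred)
    (fun i => (hU _).trans (hu _)) (fun k hk => (hU k).trans (hu0 k ?_)) hUC
    (fun i j hj => ?_) (fun j hj => ?_) fun z => (hV1 z).trans_eq (one_mul _)⟩
  · rintro ⟨n, rfl⟩
    exact hk ⟨n.succPNat, congrArg J (Nat.natPred_succPNat n)⟩
  · have h : ∃ n, j ∈ (A (remainder A M n)).support := ⟨i.natPred, hj⟩
    rw [hV, if_pos h, hA.eq_of_mem hM (hN j h) hj]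
  · rw [hV, if_neg]
    rintro ⟨n, hn⟩
    refine hj n.succPNat ?_
    have h := Nat.natPred_succPNat n
    rw [average, successive, h]
    exact hn
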